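/- Let $\mathfrak H$ be a complex separable Hilbert space with a complex conjugation $h\mapsto\bar h$ (an antiunitary involution; for $\mathfrak H=L^2(T,\nu)$ the pointwise conjugation), let the inner product $\langle\cdot,\cdot\rangle$ be linear in its first entry, and let $\{Z(h):h\in\mathfrak H\}$ be a complex Gaussian isonormal process on a probability space $(\Omega,\mathcal F,P)$, i.e. a jointly Gaussian centered complex family with $E[Z(h)^2]=0$ and $E[Z(g)\overline{Z(h)}]=\langle g,h\rangle$. Let $J_{p,q}(z,\rho)=\sum_{r=0}^{p\wedge q}(-1)^r r!\binom pr\binom qr z^{p-r}\bar z^{\,q-r}\rho^r$ be the complex Hermite polynomials and let $\{e_k\}$ be any orthonormal basis of $\mathfrak H$. For $f\in\mathfrak H^{\odot m}\otimes\mathfrak H^{\odot n}$ (a closed subspace of the Hilbert tensor power $\mathfrak H^{\otimes(m+n)}$) let $I_{m,n}(f)\in L^2(\Omega)$ be the complex multiple Wiener–Itô integral, that is, with $a_{j,l}=\langle f, e_{j_1}\otimes\dots\otimes e_{j_m}\otimes\bar e_{l_1}\otimes\dots\otimes\bar e_{l_n}\rangle$, $$I_{m,n}(f)=\sum_{j,l}a_{j,l}\,\sqrt{\mathbf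 m!\,\mathbf n!}\;\mathbf J_{\mathbf m,\mathbf n},\qquad \mathbf J_{\mathbf m,\mathbf n}=\prod_k\frac{J_{m_k,n_k}(\sqrt2 Z(e_k),2)}{\sqrt{2^{m_k+n_k}m_k!\,n_k!}},$$ where $m_k$, $n_k$ are the numbers of occurrences of $k$ in $j$ and in $l$, $\mathbf m!=\prod_k m_k!$, $\mathbf n!=\prod_k n_k!$, and the series converges in $L^2(\Omega)$. Let $D$ and $\bar D$ be the closed operators from $L^2(\Omega)$ to $L^2(\Omega;\mathfrak H)$ obtained by closing $$DF=\sum_{i}\partial_i g(Z(\varphi_1),\dots,Z(\varphi_k))\,\varphi_i,\qquad \bar DF=\sum_{i}\bar\partial_i g(Z(\varphi_1),\dots,Z(\varphi_k))\,\bar\varphi_i$$ on the smooth random variables $F=g(Z(\varphi_1),\dots,Z(\varphi_k))$, where $\varphi_i\in\mathfrak H$, $g\in C^\infty(\mathbb C^k)$ has polynomial growth together with all its derivatives, and $\partial_i$, $\bar\partial_i$ are the Wirtinger derivatives. Then for all $m,n\ge0$ and all $f\in\mathfrak H^{\odot m}\otimes\mathfrak H^{\odot n}$, the random variable $I_{m,n}(f)$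 lies in the domains of $D$ and of $\bar D$, and $$D_t\,I_{m,n}(f)=m\,I_{m-1,n}(f(t,\cdot,\cdot)),\qquad \bar D_s\,I_{m,n}(f)=n\,I_{m,n-1}(f(\cdot,s,\cdot))$$ as elements of $L^2(\Omega;\mathfrak H)$: for every $h\in\mathfrak H$, almost surely, $$\langle D I_{m,n}(f),h\rangle=m\,I_{m-1,n}(\langle f(t,\cdot,\cdot),h\rangle_t),\qquad \langle \bar D I_{m,n}(f),h\rangle=n\,I_{m,n-1}(\langle f(\cdot,s,\cdot),h\rangle_s),$$ where $\langle f(t,\cdot,\cdot),h\rangle_t\in\mathfrak H^{\odot(m-1)}\otimes\mathfrak H^{\odot n}$ (resp. $\langle f(\cdot,s,\cdot),h\rangle_s\in\mathfrak H^{\odot m}\otimes\mathfrak H^{\odot(n-1)}$) is the contraction with $h$ of one of the first $m$ (resp. last $n$) variables of $f$. For $m=0$ (resp. $n=0$) the right-hand side is $0$. -/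

import Mathlib

open MeasureTheory ProbabilityTheory Filter Topology
open scoped ENNReal NNReal InnerProductSpace

noncomputable section

namespace ComplexWiener

/-! ### Complex Hermite polynomials -/

/-- The complex Hermite polynomial `J_{m,n}(z, ρ)`, i.e. `m! n!` times the coefficient of
`conj(λ)^m * λ^n` in `exp (λ conj(z) + conj(λ) z - ρ |λ|^2)`. -/
def hermiteJ (m n : ℕ) (z : ℂ) (ρ : ℝ) : ℂ :=
  ∑ r ∈ Finset.range (min m n + 1),
    (-1) ^ r * (r.factorial : ℂ) * (m.choose r : ℂ) * (n.choose r : ℂ) *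
      z ^ (m - r) * (starRingEnd ℂ z) ^ (n - r) * (ρ : ℂ) ^ r

/-! ### Complex Gaussian isonormal processes -/

section Isonormal

variable {Ω : Type*} [MeasurableSpace Ω] {H : Type*} [NormedAddCommGroup H]
  [InnerProductSpace ℂ H]

/-- `Z` is a complex Gaussian isonormal process over `H`: a jointly Gaussian centered complex
family with `E[Z(h)^2] = 0` and `E[Z(g) conj(Z(h))] = ⟨g, h⟩`, where `⟨g, h⟩` is linear in `g`
(the inner product `⟪h, g⟫_ℂ` of Mathlib is linear in its second entry). -/
structure IsIsonormal (Z : H → Ω → ℂ) (P : Measure Ω) : Prop where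
  gaussian : IsGaussianProcess Z P
  centered : ∀ h, ∫ ω, Z h ω ∂P = 0
  symmetric : ∀ h, ∫ ω, Z h ω ^ 2 ∂P = 0
  covariance : ∀ g h, ∫ ω, Z g ω * starRingEnd ℂ (Z h ω) ∂P = ⟪h, g⟫_ℂ

end Isonormal

/-! ### Hilbert tensor powers -/

section Update

variable {V : Type*}

theorem sumElim_cons_update {m n : ℕ} [DecidableEq (Fin m ⊕ Fin n)] (φ : V)
    (x : Fin m ⊕ Fin n → V) (i : Fin m ⊕ Fin n) (v : V) :
    (Sum.elim (Fin.cons φ fun a => Function.update x i v (Sum.inl a))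
      (fun b => Function.update x i v (Sum.inr b)) : Fin (m + 1) ⊕ Fin n → V) =
    Function.update (Sum.elim (Fin.cons φ fun a => x (Sum.inl a)) fun b => x (Sum.inr b))
      (Sum.map Fin.succ id i) v := by
  funext k
  rcases k with k | k
  · refine Fin.cases ?_ (fun k => ?_) k <;> rcases i with i | i <;>
      simp [Function.update_apply, Fin.succ_ne_zero, eq_comm]
  · rcases i with i | i <;> simp [Function.update_apply]

theorem sumElim_update_cons {m n : ℕ} [DecidableEq (Fin m ⊕ Fin n)] (φ : V)
    (x : Fin m ⊕ Fin n → V) (i : Fin m ⊕ Fin n) (v : V) :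
    (Sum.elim (fun a => Function.update x i v (Sum.inl a))
      (Fin.cons φ fun b => Function.update x i v (Sum.inr b)) : Fin m ⊕ Fin (n + 1) → V) =
    Function.update (Sum.elim (fun a => x (Sum.inl a)) (Fin.cons φ fun b => x (Sum.inr b)))
      (Sum.map id Fin.succ i) v := by
  funext k
  rcases k with k | k
  · rcases i with i | i <;> simp [Function.update_apply]
  · refine Fin.cases ?_ (fun k => ?_) k <;> rcases i with i | i <;>
      simp [Function.update_apply, Fin.succ_ne_zero, eq_comm]

theorem sum_piFinset_cons {k : ℕ} (u : V) (s : Fin k → Finset V) (F : (Fin (k + 1) → V) → ℝ) :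
    ∑ x ∈ Fintype.piFinset (Fin.cons {u} s : Fin (k + 1) → Finset V), F x =
      ∑ x ∈ Fintype.piFinset s, F (Fin.cons u x) := by
  symm
  refine Finset.sum_bij (fun x _ => (Fin.cons u x : Fin (k + 1) → V)) ?_ ?_ ?_ ?_
  · intro x hx
    rw [Fintype.mem_piFinset] at hx ⊢
    intro a
    refine Fin.cases ?_ (fun b => ?_) a
    · simp
    · simpa using hx b
  · intro x _ y _ hxy
    exact (Fin.cons_inj.1 hxy).2
  · intro x hx
    rw [Fintype.mem_piFinset] at hx
    refine ⟨Fin.tail x, ?_, ?_⟩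
    · rw [Fintype.mem_piFinset]
      intro a
      simpa [Fin.tail] using hx a.succ
    · have h0 : x 0 = u := by simpa using hx 0
      rw [← h0, Fin.cons_self_tail]
  · intro x _
    rfl

end Update

section Tensor

variable (H : Type*) [NormedAddCommGroup H] [InnerProductSpace ℂ H]

/-- Bounded multilinear functionals of `m + n` variables in the dual of `H`, the first `m`
variables being separated from the last `n`. The elementary tensor
`(x₁ ⊗ ⋯ ⊗ x_m) ⊗ (y₁ ⊗ ⋯ ⊗ y_n)` is the functional
`(φ, ψ) ↦ φ₁(x₁) ⋯ φ_m(x_m) ψ₁(y₁) ⋯ ψ_n(y_n)`. -/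
abbrev TensorForm (m n : ℕ) : Type _ :=
  ContinuousMultilinearMap ℂ (fun _ : Fin m ⊕ Fin n => StrongDual ℂ H) ℂ

variable {H}

/-- The value of `f` at `(φ₁, …, φ_m, ψ₁, …, ψ_n)`. -/
def TensorForm.eval {m n : ℕ} (f : TensorForm H m n) (φ : Fin m → StrongDual ℂ H)
    (ψ : Fin n → StrongDual ℂ H) : ℂ :=
  f (Sum.elim φ ψ)

/-- Contraction of the first of the first `m + 1` variables with a functional. -/
def TensorForm.evalLeft {m n : ℕ} (f : TensorForm H (m + 1) n) (φ : StrongDual ℂ H) :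
    TensorForm H m n where
  toFun x := f.eval (Fin.cons φ fun a => x (Sum.inl a)) fun b => x (Sum.inr b)
  map_update_add' x i v w := by
    rw [TensorForm.eval, TensorForm.eval, TensorForm.eval, sumElim_cons_update,
      sumElim_cons_update, sumElim_cons_update, f.map_update_add]
  map_update_smul' x i c v := by
    rw [TensorForm.eval, TensorForm.eval, sumElim_cons_update, sumElim_cons_update,
      f.map_update_smul]
  cont := by
    refine f.cont.comp (continuous_pi fun i => ?_)
    rcases i with i | i
    · refine Fin.cases ?_ (fun k => ?_) i
      · simpa using continuous_const
      · simpa using continuous_apply _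
    · simpa using continuous_apply _

/-- Contraction of the first of the last `n + 1` variables with a functional. -/
def TensorForm.evalRight {m n : ℕ} (f : TensorForm H m (n + 1)) (φ : StrongDual ℂ H) :
    TensorForm H m n where
  toFun x := f.eval (fun a => x (Sum.inl a)) (Fin.cons φ fun b => x (Sum.inr b))
  map_update_add' x i v w := by
    rw [TensorForm.eval, TensorForm.eval, TensorForm.eval, sumElim_update_cons,
      sumElim_update_cons, sumElim_update_cons, f.map_update_add]
  map_update_smul' x i c v := by
    rw [TensorForm.eval, TensorForm.eval, sumElim_update_cons, sumElim_update_cons,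
      f.map_update_smul]
  cont := by
    refine f.cont.comp (continuous_pi fun i => ?_)
    rcases i with i | i
    · simpa using continuous_apply _
    · refine Fin.cases ?_ (fun k => ?_) i
      · simpa using continuous_const
      · simpa using continuous_apply _

theorem evalLeft_eval {m n : ℕ} (f : TensorForm H (m + 1) n) (φ : StrongDual ℂ H)
    (x : Fin m → StrongDual ℂ H) (y : Fin n → StrongDual ℂ H) :
    (f.evalLeft φ).eval x y = f.eval (Fin.cons φ x) y := rfl

theorem evalRight_eval {m n : ℕ} (f : TensorForm H m (n + 1)) (φ : StrongDual ℂ H)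
    (x : Fin m → StrongDual ℂ H) (y : Fin n → StrongDual ℂ H) :
    (f.evalRight φ).eval x y = f.eval x (Fin.cons φ y) := rfl

theorem eval_cons_smul_left {m n : ℕ} (f : TensorForm H (m + 1) n) (c : ℂ) (φ : StrongDual ℂ H)
    (x : Fin m → StrongDual ℂ H) (y : Fin n → StrongDual ℂ H) :
    f.eval (Fin.cons (c • φ) x) y = c * f.eval (Fin.cons φ x) y := by
  have h : ∀ v : StrongDual ℂ H, (Sum.elim (Fin.cons v x) y : Fin (m + 1) ⊕ Fin n → _) =
      Function.update (Sum.elim (Fin.cons φ x) y) (Sum.inl 0) v := fun v => by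
    rw [← Sum.elim_update_left, Fin.update_cons_zero]
  rw [TensorForm.eval, TensorForm.eval, h (c • φ), f.map_update_smul, ← h φ, smul_eq_mul]

theorem eval_cons_smul_right {m n : ℕ} (f : TensorForm H m (n + 1)) (c : ℂ) (φ : StrongDual ℂ H)
    (x : Fin m → StrongDual ℂ H) (y : Fin n → StrongDual ℂ H) :
    f.eval x (Fin.cons (c • φ) y) = c * f.eval x (Fin.cons φ y) := by
  have h : ∀ v : StrongDual ℂ H, (Sum.elim x (Fin.cons v y) : Fin m ⊕ Fin (n + 1) → _) =
      Function.update (Sum.elim x (Fin.cons φ y)) (Sum.inr 0) v := fun v => by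
    rw [← Sum.elim_update_right, Fin.update_cons_zero]
  rw [TensorForm.eval, TensorForm.eval, h (c • φ), f.map_update_smul, ← h φ, smul_eq_mul]

/-- Symmetry in the first `m` variables and in the last `n` variables. -/
def IsSymm {m n : ℕ} (f : TensorForm H m n) : Prop :=
  ∀ (π : Equiv.Perm (Fin m)) (σ : Equiv.Perm (Fin n)) (φ : Fin m → StrongDual ℂ H)
    (ψ : Fin n → StrongDual ℂ H),
    f.eval (fun a => φ (π a)) (fun b => ψ (σ b)) = f.eval φ ψ

theorem cons_comp_perm {k : ℕ} (π : Equiv.Perm (Fin k)) (φ : StrongDual ℂ H)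
    (x : Fin k → StrongDual ℂ H) :
    (Fin.cons φ (fun a => x (π a)) : Fin (k + 1) → StrongDual ℂ H) =
      fun a => (Fin.cons φ x : Fin (k + 1) → StrongDual ℂ H)
        (Equiv.Perm.decomposeFin.symm (0, π) a) := by
  funext a
  refine Fin.cases ?_ (fun b => ?_) a <;> simp

theorem isSymm_evalLeft {m n : ℕ} {f : TensorForm H (m + 1) n} (hf : IsSymm f)
    (φ : StrongDual ℂ H) : IsSymm (f.evalLeft φ) := by
  intro π σ x y
  rw [evalLeft_eval, evalLeft_eval, cons_comp_perm]
  exact hf _ σ _ y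

theorem isSymm_evalRight {m n : ℕ} {f : TensorForm H m (n + 1)} (hf : IsSymm f)
    (φ : StrongDual ℂ H) : IsSymm (f.evalRight φ) := by
  intro π σ x y
  rw [evalRight_eval, evalRight_eval, cons_comp_perm]
  exact hf π _ x _

theorem orthonormal_cons {k : ℕ} {u : H} (hu : ‖u‖ = 1) {s : Fin k → Finset H}
    (hs : ∀ a, Orthonormal ℂ ((↑) : s a → H)) (a : Fin (k + 1)) :
    Orthonormal ℂ ((↑) : (Fin.cons {u} s : Fin (k + 1) → Finset H) a → H) := by
  refine Fin.cases ?_ (fun b => ?_) a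
  · rw [Fin.cons_zero]
    refine ⟨fun i => ?_, fun i j hij => ?_⟩
    · have := Finset.mem_singleton.1 i.2
      rw [this, hu]
    · exact absurd (Subtype.ext ((Finset.mem_singleton.1 i.2).trans
        (Finset.mem_singleton.1 j.2).symm)) hij
  · rw [Fin.cons_succ]
    exact hs b

variable [CompleteSpace H]

/-- The functional `⟨·, h⟩` on `H`. -/
def dual (h : H) : StrongDual ℂ H := InnerProductSpace.toDual ℂ H h

/-- The inner product `⟨f, (x₁ ⊗ ⋯ ⊗ x_m) ⊗ (y₁ ⊗ ⋯ ⊗ y_n)⟩`, linear in `f`. -/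
def TensorForm.coeff {m n : ℕ} (f : TensorForm H m n) (x : Fin m → H) (y : Fin n → H) : ℂ :=
  f.eval (fun a => dual (x a)) (fun b => dual (y b))

/-- The Hilbert--Schmidt condition: the sums `∑ |⟨f, v₁ ⊗ ⋯ ⊗ v_{m+n}⟩|^2`, with `v_i` running over
a finite orthonormal set that may depend on `i`, are bounded. The bounded multilinear functionals
with this property are exactly the elements of the Hilbert tensor product `H^{⊗ (m + n)}`. -/
def IsHilbertSchmidt {m n : ℕ} (f : TensorForm H m n) : Prop :=
  ∃ C : ℝ, ∀ (s : Fin m → Finset H) (t : Fin n → Finset H),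
    (∀ a, Orthonormal ℂ ((↑) : s a → H)) → (∀ b, Orthonormal ℂ ((↑) : t b → H)) →
      ∑ x ∈ Fintype.piFinset s, ∑ y ∈ Fintype.piFinset t, ‖f.coeff x y‖ ^ 2 ≤ C

variable (H) in
/-- The space `H^{⊙ m} ⊗ H^{⊙ n}` of kernels. -/
def SymKernel (m n : ℕ) : Submodule ℂ (TensorForm H m n) where
  carrier := {f | IsHilbertSchmidt f ∧ IsSymm f}
  zero_mem' := ⟨⟨0, by simp [TensorForm.coeff, TensorForm.eval]⟩, by simp [IsSymm, TensorForm.eval]⟩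
  add_mem' := by
    rintro f g ⟨⟨C, hC⟩, hf⟩ ⟨⟨D, hD⟩, hg⟩
    refine ⟨⟨2 * C + 2 * D, fun s t hs ht => ?_⟩, fun π σ φ ψ => ?_⟩
    · have h1 := hC s t hs ht
      have h2 := hD s t hs ht
      calc ∑ x ∈ Fintype.piFinset s, ∑ y ∈ Fintype.piFinset t, ‖(f + g).coeff x y‖ ^ 2
          ≤ ∑ x ∈ Fintype.piFinset s, ∑ y ∈ Fintype.piFinset t,
              (2 * ‖f.coeff x y‖ ^ 2 + 2 * ‖g.coeff x y‖ ^ 2) := by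
            refine Finset.sum_le_sum fun x _ => Finset.sum_le_sum fun y _ => ?_
            have h3 : ‖(f + g).coeff x y‖ ≤ ‖f.coeff x y‖ + ‖g.coeff x y‖ := norm_add_le _ _
            nlinarith [norm_nonneg ((f + g).coeff x y), norm_nonneg (f.coeff x y),
              norm_nonneg (g.coeff x y), sq_nonneg (‖f.coeff x y‖ - ‖g.coeff x y‖)]
        _ ≤ 2 * C + 2 * D := by
            simp only [Finset.sum_add_distrib, ← Finset.mul_sum]
            linarith
    · have h1 := hf π σ φ ψ
      have h2 := hg π σ φ ψ
      simp only [TensorForm.eval, _root_.add_apply] at h1 h2 ⊢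
      rw [h1, h2]
  smul_mem' := by
    rintro c f ⟨⟨C, hC⟩, hf⟩
    refine ⟨⟨‖c‖ ^ 2 * C, fun s t hs ht => ?_⟩, fun π σ φ ψ => ?_⟩
    · have h1 : ∀ x y, ‖(c • f).coeff x y‖ ^ 2 = ‖c‖ ^ 2 * ‖f.coeff x y‖ ^ 2 := fun x y => by
        simp [TensorForm.coeff, TensorForm.eval, mul_pow]
      simp only [h1, ← Finset.mul_sum]
      exact mul_le_mul_of_nonneg_left (hC s t hs ht) (by positivity)
    · have h1 := hf π σ φ ψ
      simp only [TensorForm.eval, _root_.smul_apply] at h1 ⊢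
      rw [h1]

theorem dual_cons {k : ℕ} (u : H) (x : Fin k → H) :
    (fun a => dual ((Fin.cons u x : Fin (k + 1) → H) a)) =
      (Fin.cons (dual u) (fun a => dual (x a)) : Fin (k + 1) → StrongDual ℂ H) := by
  funext a
  refine Fin.cases ?_ (fun b => ?_) a <;> simp

theorem coeff_evalLeft {m n : ℕ} (f : TensorForm H (m + 1) n) (u : H)
    (x : Fin m → H) (y : Fin n → H) :
    (f.evalLeft (dual u)).coeff x y = f.coeff (Fin.cons u x) y := by
  rw [TensorForm.coeff, TensorForm.coeff, evalLeft_eval, dual_cons]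

theorem coeff_evalRight {m n : ℕ} (f : TensorForm H m (n + 1)) (u : H)
    (x : Fin m → H) (y : Fin n → H) :
    (f.evalRight (dual u)).coeff x y = f.coeff x (Fin.cons u y) := by
  rw [TensorForm.coeff, TensorForm.coeff, evalRight_eval, dual_cons]

theorem dual_eq_smul (h : H) (hh : h ≠ 0) :
    ∃ u : H, ‖u‖ = 1 ∧ dual h = (‖h‖ : ℂ) • dual u := by
  have h0 : ‖h‖ ≠ 0 := norm_ne_zero_iff.2 hh
  refine ⟨((‖h‖ : ℂ)⁻¹) • h, ?_, ?_⟩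
  · rw [norm_smul, norm_inv, Complex.norm_real, norm_norm, inv_mul_cancel₀ h0]
  · rw [dual, dual, map_smulₛₗ, map_inv₀, Complex.conj_ofReal, smul_smul,
      mul_inv_cancel₀ (by exact_mod_cast h0), one_smul]

theorem isHilbertSchmidt_evalLeft {m n : ℕ} {f : TensorForm H (m + 1) n}
    (hf : IsHilbertSchmidt f) (h : H) : IsHilbertSchmidt (f.evalLeft (dual h)) := by
  obtain ⟨C, hC⟩ := hf
  obtain ⟨c, u, hu, hhu⟩ : ∃ (c : ℂ) (u : H), (c = 0 ∨ ‖u‖ = 1) ∧ dual h = c • dual u := by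
    by_cases hh : h = 0
    · exact ⟨0, 0, Or.inl rfl, by ext v; simp [hh, dual]⟩
    · obtain ⟨u, hu, hhu⟩ := dual_eq_smul h hh
      exact ⟨_, u, Or.inr hu, hhu⟩
  have h3 : ∀ x y, ‖(f.evalLeft (dual h)).coeff x y‖ ^ 2 =
      ‖c‖ ^ 2 * ‖f.coeff (Fin.cons u x) y‖ ^ 2 := fun x y => by
    rw [← coeff_evalLeft, TensorForm.coeff, TensorForm.coeff, evalLeft_eval, evalLeft_eval, hhu,
      eval_cons_smul_left, norm_mul, mul_pow]
  refine ⟨‖c‖ ^ 2 * C, fun s t hs ht => ?_⟩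
  simp only [h3, ← Finset.mul_sum]
  rcases hu with rfl | hu
  · simp
  · have h2 := hC (Fin.cons {u} s) t (orthonormal_cons hu hs) ht
    rw [sum_piFinset_cons] at h2
    exact mul_le_mul_of_nonneg_left h2 (by positivity)

theorem isHilbertSchmidt_evalRight {m n : ℕ} {f : TensorForm H m (n + 1)}
    (hf : IsHilbertSchmidt f) (h : H) : IsHilbertSchmidt (f.evalRight (dual h)) := by
  obtain ⟨C, hC⟩ := hf
  obtain ⟨c, u, hu, hhu⟩ : ∃ (c : ℂ) (u : H), (c = 0 ∨ ‖u‖ = 1) ∧ dual h = c • dual u := by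
    by_cases hh : h = 0
    · exact ⟨0, 0, Or.inl rfl, by ext v; simp [hh, dual]⟩
    · obtain ⟨u, hu, hhu⟩ := dual_eq_smul h hh
      exact ⟨_, u, Or.inr hu, hhu⟩
  have h3 : ∀ x y, ‖(f.evalRight (dual h)).coeff x y‖ ^ 2 =
      ‖c‖ ^ 2 * ‖f.coeff x (Fin.cons u y)‖ ^ 2 := fun x y => by
    rw [← coeff_evalRight, TensorForm.coeff, TensorForm.coeff, evalRight_eval, evalRight_eval, hhu,
      eval_cons_smul_right, norm_mul, mul_pow]
  refine ⟨‖c‖ ^ 2 * C, fun s t hs ht => ?_⟩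
  simp only [h3, ← Finset.mul_sum]
  rcases hu with rfl | hu
  · simp
  · have h2 := hC s (Fin.cons {u} t) hs (orthonormal_cons hu ht)
    simp only [sum_piFinset_cons] at h2
    exact mul_le_mul_of_nonneg_left h2 (by positivity)

/-- The slice of `f ∈ H^{⊙ m} ⊗ H^{⊙ n}` in one of its first `m` variables, tested against `h`:
`f(h) = ⟨f(t, ·, ·), h⟩_t ∈ H^{⊙ (m-1)} ⊗ H^{⊙ n}`. For `m = 0` there is no such variable and the
value is `0`. -/
def sliceLeft : {m n : ℕ} → SymKernel H m n → H → SymKernel H (m - 1) n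
  | 0, _, _, _ => 0
  | _ + 1, _, f, h => ⟨f.1.evalLeft (dual h),
      isHilbertSchmidt_evalLeft f.2.1 h, isSymm_evalLeft f.2.2 _⟩

/-- The slice of `f ∈ H^{⊙ m} ⊗ H^{⊙ n}` in one of its last `n` variables, tested against `h`:
`⟨f(·, s, ·), h⟩_s ∈ H^{⊙ m} ⊗ H^{⊙ (n-1)}`. For `n = 0` there is no such variable and the
value is `0`. -/
def sliceRight : {m n : ℕ} → SymKernel H m n → H → SymKernel H m (n - 1)
  | _, 0, _, _ => 0
  | _, _ + 1, f, h => ⟨f.1.evalRight (dual h),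
      isHilbertSchmidt_evalRight f.2.1 h, isSymm_evalRight f.2.2 _⟩

end Tensor

/-! ### Multiple Wiener--Itô integrals -/

section Integral

variable {Ω : Type*} [MeasurableSpace Ω] {P : Measure Ω} {H : Type*} [NormedAddCommGroup H]
  [InnerProductSpace ℂ H] {ι : Type*}

/-- The number of occurrences of `k` in the list of indices `j`. -/
def mult {m : ℕ} (j : Fin m → ι) (k : ι) : ℕ := Nat.card {a : Fin m // j a = k}

open Classical in
/-- The indices that occur in `j` or in `l`. -/
def support {m n : ℕ} (j : Fin m → ι) (l : Fin n → ι) : Finset ι :=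
  Finset.univ.image j ∪ Finset.univ.image l

/-- The Fourier--Hermite polynomial
`∏_k (2^{m_k + n_k} m_k! n_k!)^{-1/2} J_{m_k, n_k}(√2 Z(e_k), 2)`, where `m_k` and `n_k` are the
multiplicities of `k` in `j` and `l`; indices outside the support contribute the factor `1`. -/
def fourierHermite (Z : H → Ω → ℂ) (e : ι → H) {m n : ℕ} (j : Fin m → ι) (l : Fin n → ι)
    (ω : Ω) : ℂ :=
  ∏ k ∈ support j l,
    (((1 / √((2 : ℝ) ^ (mult j k + mult l k) * (mult j k).factorial * (mult l k).factorial) :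
      ℝ) : ℂ) * hermiteJ (mult j k) (mult l k) (((√2 : ℝ) : ℂ) * Z (e k) ω) 2)

/-- `√(𝐦! 𝐧!)` for the multi-indices `𝐦`, `𝐧` of multiplicities of `j`, `l`. -/
def sqrtFactorial {m n : ℕ} (j : Fin m → ι) (l : Fin n → ι) : ℝ :=
  √(∏ k ∈ support j l, ((mult j k).factorial * (mult l k).factorial : ℝ))

theorem memLp_finset_prod {κ : Type*} [IsFiniteMeasure P] (s : Finset κ) (X : κ → Ω → ℂ)
    (hX : ∀ i ∈ s, ∀ p : ℝ≥0∞, p ≠ ∞ → MemLp (X i) p P) (p : ℝ≥0∞) (hp : p ≠ ∞) :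
    MemLp (fun ω => ∏ i ∈ s, X i ω) p P := by
  classical
  induction s using Finset.induction_on generalizing p with
  | empty => simpa using memLp_const (1 : ℂ)
  | insert a s ha ih =>
    simp only [Finset.prod_insert ha]
    have h1 := hX a (Finset.mem_insert_self a s) (2 * p) (ENNReal.mul_ne_top (by simp) hp)
    have h2 := ih (fun i hi => hX i (Finset.mem_insert_of_mem hi)) (2 * p)
      (ENNReal.mul_ne_top (by simp) hp)
    have : ENNReal.HolderTriple (2 * p) (2 * p) p := ⟨by
      rw [ENNReal.mul_inv (by simp) (by simp), ← add_mul, ENNReal.inv_two_add_inv_two, one_mul]⟩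
    exact h2.mul' h1

theorem memLp_hermiteJ [IsFiniteMeasure P] {X : Ω → ℂ} (hX : ∀ p : ℝ≥0∞, p ≠ ∞ → MemLp X p P)
    (m n : ℕ) (ρ : ℝ) (p : ℝ≥0∞) (hp : p ≠ ∞) :
    MemLp (fun ω => hermiteJ m n (X ω) ρ) p P := by
  have hpow : ∀ (Y : Ω → ℂ), (∀ p : ℝ≥0∞, p ≠ ∞ → MemLp Y p P) → ∀ (k : ℕ) (p : ℝ≥0∞), p ≠ ∞ →
      MemLp (fun ω => Y ω ^ k) p P := fun Y hY k p hp => by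
    simpa using memLp_finset_prod (Finset.range k) (fun _ => Y) (fun _ _ => hY) p hp
  have hmul : ∀ (Y W : Ω → ℂ), (∀ p : ℝ≥0∞, p ≠ ∞ → MemLp Y p P) →
      (∀ p : ℝ≥0∞, p ≠ ∞ → MemLp W p P) → ∀ (p : ℝ≥0∞), p ≠ ∞ →
      MemLp (fun ω => Y ω * W ω) p P := fun Y W hY hW p hp => by
    have := memLp_finset_prod Finset.univ ![Y, W] (fun i _ => by fin_cases i <;> assumption) p hp
    simpa [Fin.prod_univ_two] using this
  unfold hermiteJ
  refine memLp_finsetSum _ fun r _ => ?_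
  refine MemLp.mul_const ?_ _
  refine hmul _ _ (fun q hq => ?_) (hpow _ (fun q hq => ?_) _) p hp
  · exact (hpow X hX _ q hq).const_mul _
  · exact (hX q hq).star

theorem memLp_fourierHermite [IsProbabilityMeasure P] {Z : H → Ω → ℂ} (hZ : IsIsonormal Z P)
    (e : ι → H) {m n : ℕ} (j : Fin m → ι) (l : Fin n → ι) :
    MemLp (fourierHermite Z e j l) 2 P := by
  refine memLp_finset_prod _ _ (fun k _ p hp => ?_) 2 (by simp)
  refine MemLp.const_mul (memLp_hermiteJ (fun q hq => ?_) _ _ _ p hp) _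
  exact ((hZ.gaussian.hasGaussianLaw_eval (e k)).memLp hq).const_mul _

/-- The random variable `√(𝐦! 𝐧!) 𝐉_{𝐦,𝐧}` as an element of `L²(Ω)`; it is the multiple integral of
`e_{j₁} ⊗ ⋯ ⊗ e_{j_m} ⊗ conj(e_{l₁}) ⊗ ⋯ ⊗ conj(e_{l_n})`. -/
def basisIntegral [IsProbabilityMeasure P] {Z : H → Ω → ℂ} (hZ : IsIsonormal Z P)
    (e : ι → H) {m n : ℕ} (j : Fin m → ι) (l : Fin n → ι) : Lp ℂ 2 P :=
  (sqrtFactorial j l : ℂ) • (memLp_fourierHermite hZ e j l).toLp (fourierHermite Z e j l)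

/-- The complex multiple Wiener--Itô integral `I_{m,n}(f)`, by linear and isometric extension of
its values on the elementary tensors of the orthonormal basis `e`: expand
`f = ∑ a_{j,l} e_{j₁} ⊗ ⋯ ⊗ e_{j_m} ⊗ conj(e_{l₁}) ⊗ ⋯ ⊗ conj(e_{l_n})` and sum, in `L²(Ω)`. The
complex conjugation of `H` is denoted by `J`. -/
def multipleIntegral [CompleteSpace H] [IsProbabilityMeasure P] {Z : H → Ω → ℂ}
    (hZ : IsIsonormal Z P) (J : H ≃ₗᵢ⋆[ℂ] H) (e : HilbertBasis ι ℂ H) (m n : ℕ)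
    (f : SymKernel H m n) : Lp ℂ 2 P :=
  ∑' q : (Fin m → ι) × (Fin n → ι),
    f.1.coeff (fun a => e (q.1 a)) (fun b => J (e (q.2 b))) • basisIntegral hZ e q.1 q.2

end Integral

/-! ### Complex Malliavin derivatives -/

section Malliavin

/-- The Wirtinger derivative `∂f/∂z_i = (∂f/∂x_i - i ∂f/∂y_i) / 2`. -/
def wirtinger {k : ℕ} (f : (Fin k → ℂ) → ℂ) (i : Fin k) (z : Fin k → ℂ) : ℂ :=
  (1 / 2) * (fderiv ℝ f z (Pi.single i 1) - Complex.I * fderiv ℝ f z (Pi.single i Complex.I))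

/-- The Wirtinger derivative `∂f/∂conj(z_i) = (∂f/∂x_i + i ∂f/∂y_i) / 2`. -/
def wirtingerBar {k : ℕ} (f : (Fin k → ℂ) → ℂ) (i : Fin k) (z : Fin k → ℂ) : ℂ :=
  (1 / 2) * (fderiv ℝ f z (Pi.single i 1) + Complex.I * fderiv ℝ f z (Pi.single i Complex.I))

variable {Ω : Type*} [MeasurableSpace Ω] (P : Measure Ω) {H : Type*} [NormedAddCommGroup H]
  [InnerProductSpace ℂ H]

/-- The graph of `D` on smooth random variables `F = f(Z(φ₁), …, Z(φ_k))`, with `f` smooth and all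
its derivatives of polynomial growth: `D F = ∑ ∂_i f(Z(φ₁), …, Z(φ_k)) φ_i`. -/
def smoothGraph (Z : H → Ω → ℂ) : Set (Lp ℂ 2 P × Lp H 2 P) :=
  {p | ∃ (k : ℕ) (φ : Fin k → H) (f : (Fin k → ℂ) → ℂ), f.HasTemperateGrowth ∧
    (p.1 : Ω → ℂ) =ᵐ[P] (fun ω => f fun i => Z (φ i) ω) ∧
    (p.2 : Ω → H) =ᵐ[P] (fun ω => ∑ i, wirtinger f i (fun i' => Z (φ i') ω) • φ i)}

/-- The graph of `D̄` on smooth random variables: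
`D̄ F = ∑ ∂̄_i f(Z(φ₁), …, Z(φ_k)) conj(φ_i)`, the conjugation of `H` being `J`. -/
def smoothGraphBar (J : H ≃ₗᵢ⋆[ℂ] H) (Z : H → Ω → ℂ) : Set (Lp ℂ 2 P × Lp H 2 P) :=
  {p | ∃ (k : ℕ) (φ : Fin k → H) (f : (Fin k → ℂ) → ℂ), f.HasTemperateGrowth ∧
    (p.1 : Ω → ℂ) =ᵐ[P] (fun ω => f fun i => Z (φ i) ω) ∧
    (p.2 : Ω → H) =ᵐ[P] (fun ω => ∑ i, wirtingerBar f i (fun i' => Z (φ i') ω) • J (φ i))}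

/-- `(F, G)` belongs to the graph of the closure of `D` from `L²(Ω)` to `L²(Ω; H)`. -/
def InGraphD (Z : H → Ω → ℂ) (F : Lp ℂ 2 P) (G : Lp H 2 P) : Prop :=
  (F, G) ∈ closure (smoothGraph P Z)

/-- `(F, G)` belongs to the graph of the closure of `D̄` from `L²(Ω)` to `L²(Ω; H)`. -/
def InGraphDBar (J : H ≃ₗᵢ⋆[ℂ] H) (Z : H → Ω → ℂ) (F : Lp ℂ 2 P) (G : Lp H 2 P) : Prop :=
  (F, G) ∈ closure (smoothGraphBar P J Z)

/-- `F` lies in the domain of the closed operator `D`, and `D F = G`: the pair lies in the closed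
graph, and no other value is attached to `F` by the closed graph. -/
def HasD (Z : H → Ω → ℂ) (F : Lp ℂ 2 P) (G : Lp H 2 P) : Prop :=
  ∀ G', InGraphD P Z F G' ↔ G' = G

/-- `F` lies in the domain of the closed operator `D̄`, and `D̄ F = G`. -/
def HasDBar (J : H ≃ₗᵢ⋆[ℂ] H) (Z : H → Ω → ℂ) (F : Lp ℂ 2 P) (G : Lp H 2 P) : Prop :=
  ∀ G', InGraphDBar P J Z F G' ↔ G' = G

end Malliavin

end ComplexWiener

end

/-!
Both derivatives are computed on the Fourier--Hermite expansion of `I_{m,n}(f)`.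

The operator `D` is closable because of Gaussian integration by parts: for smooth variables `F`, `Φ`
and `h ∈ H`, the expectation of `⟨DF, h⟩ conj Φ` equals that of `F` times the conjugate of a smooth
variable built from `Φ` and `h`, in which no derivative of `F` is left. If `(0, K)` is in the closed
graph, the components of `K` are therefore orthogonal to all smooth variables; being limits of such
variables themselves, they vanish (`IsIsonormal.inGraphD_unique`). It thus suffices to exhibit one
element of the closed graph over `I_{m,n}(f)`.

In the coordinates `Z(e_k)` the basis integrals are the products `hermiteProd` of complex Hermite
polynomials, whose Wirtinger derivatives are obtained by deleting one index from the list. The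
adjoint relation that comes with integration by parts gives, by induction on the length of the index
lists, a Bessel inequality for the basis integrals (`IsIsonormal.isBessel_basisIntegral`). Hence
every series of basis integrals with square summable coefficients converges in `L²(Ω)`, and so does
the series of the derivatives in `L²(Ω; H)`. The sums over index lists with entries in a finite set
are smooth variables, and by symmetry of the kernel the `m` terms of their derivative coincide;
passing to the limit gives an element of the closed graph (`exists_inGraphD_arrayIntegral`).
Its component along `h` is a series whose coefficients are those of the contracted kernel
(`hasSum_coeff_cons_left`).

The statement for `D̄` follows from the one for `D`, since `D̄ F` is the conjugate of `D (conj F)`, and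
conjugation exchanges the two index lists of a basis integral (`inGraphDBar_iff`,
`conjLp_arrayIntegral`).
-/

namespace ComplexWiener

/-! ### Functions of temperate growth and their moments -/

section Temperate

variable {E F : Type*} [NormedAddCommGroup E] [NormedSpace ℝ E] [NormedAddCommGroup F]
  [NormedSpace ℝ F]

theorem hasTemperateGrowth_fderiv {f : E → F} (hf : f.HasTemperateGrowth) :
    (fderiv ℝ f).HasTemperateGrowth := by
  refine ⟨hf.1.fderiv_right (by simp), fun n => ?_⟩
  obtain ⟨k, C, h⟩ := hf.2 (n + 1)
  exact ⟨k, C, fun x => by rw [norm_iteratedFDeriv_fderiv]; exact h x⟩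

theorem hasTemperateGrowth_fderiv_apply {f : E → F} (hf : f.HasTemperateGrowth) (v : E) :
    (fun x => fderiv ℝ f x v).HasTemperateGrowth :=
  (ContinuousLinearMap.apply ℝ F v).hasTemperateGrowth.comp (hasTemperateGrowth_fderiv hf)

theorem hasTemperateGrowth_conj {f : E → ℂ} (hf : f.HasTemperateGrowth) :
    (fun x => starRingEnd ℂ (f x)).HasTemperateGrowth :=
  Complex.conjCLE.toContinuousLinearMap.hasTemperateGrowth.comp hf

theorem hasTemperateGrowth_prod {κ : Type*} (s : Finset κ) {f : κ → E → ℂ}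
    (hf : ∀ i ∈ s, (f i).HasTemperateGrowth) :
    (fun x => ∏ i ∈ s, f i x).HasTemperateGrowth := by
  classical
  induction s using Finset.induction_on with
  | empty => simp
  | insert a s ha ih =>
    simp only [Finset.prod_insert ha]
    exact (hf a (Finset.mem_insert_self a s)).fun_mul
      (ih fun i hi => hf i (Finset.mem_insert_of_mem hi))

variable {Ω : Type*} [MeasurableSpace Ω] {P : Measure Ω}

/-- A function of temperate growth of a Gaussian vector has moments of all orders. -/
theorem memLp_comp_gaussian [MeasurableSpace E] [BorelSpace E] [CompleteSpace E]
    [SecondCountableTopology E] {X : Ω → E} (hX : HasGaussianLaw X P) {f : E → ℂ}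
    (hf : f.HasTemperateGrowth) {p : ℝ≥0∞} (hp : p ≠ ∞) :
    MemLp (fun ω => f (X ω)) p P := by
  have := hX.isProbabilityMeasure
  obtain ⟨k, C, h⟩ := hf.2 0
  have h1 : MemLp (fun ω => ∏ i ∈ Finset.range k, ((1 + ‖X ω‖ : ℝ) : ℂ)) p P := by
    refine memLp_finset_prod (P := P) (Finset.range k) (fun _ ω => ((1 + ‖X ω‖ : ℝ) : ℂ))
      (fun i _ q hq => ?_) p hp
    have h2 : MemLp (fun ω => 1 + ‖X ω‖) q P := (memLp_const (1 : ℝ)).add (hX.memLp hq).norm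
    exact h2.ofReal (K := ℂ)
  refine MemLp.of_le_mul (c := C) h1
    (hf.1.continuous.comp_aestronglyMeasurable hX.aemeasurable.aestronglyMeasurable)
    (ae_of_all _ fun ω => ?_)
  have h2 := h (X ω)
  rw [norm_iteratedFDeriv_zero] at h2
  have h3 : (0 : ℝ) ≤ 1 + ‖X ω‖ := by positivity
  rwa [Finset.prod_const, Finset.card_range, norm_pow, Complex.norm_real, Real.norm_of_nonneg h3]

end Temperate

/-! ### Gaussian integration by parts -/

section Gaussian

theorem hasDerivAt_gaussianPDFReal {v : ℝ≥0} (hv : v ≠ 0) (x : ℝ) :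
    HasDerivAt (gaussianPDFReal 0 v) (-(x / v) * gaussianPDFReal 0 v x) x := by
  have hv' : (v : ℝ) ≠ 0 := by exact_mod_cast hv
  have h1 : HasDerivAt (fun x : ℝ => -(x - 0) ^ 2 / (2 * v)) (-(x / v)) x := by
    have h := (((hasDerivAt_id x).sub_const (0 : ℝ)).pow 2).neg.div_const (2 * (v : ℝ))
    refine (h.congr_deriv ?_)
    simp
    field_simp
  rw [gaussianPDFReal_def]
  refine ((h1.exp).const_mul _).congr_deriv ?_
  ring

/-- Integrability with respect to a nondegenerate Gaussian measure in terms of its density. -/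
theorem integrable_gaussianReal_iff {v : ℝ≥0} (hv : v ≠ 0) {g : ℝ → ℂ} :
    Integrable g (gaussianReal 0 v) ↔
      Integrable fun x : ℝ => (gaussianPDFReal 0 v x : ℂ) * g x := by
  rw [gaussianReal_of_var_ne_zero _ hv, gaussianPDF_def]
  rw [integrable_withDensity_iff_integrable_smul₀']
  · refine integrable_congr (ae_of_all _ fun x => ?_)
    simp [ENNReal.toReal_ofReal (gaussianPDFReal_nonneg 0 v x)]
  · exact (measurable_gaussianPDF 0 v).aemeasurable
  · exact ae_of_all _ fun _ => gaussianPDF_lt_top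

/-- Integration by parts for a centered Gaussian measure on the line. -/
theorem integral_mul_gaussianReal {v : ℝ≥0} (hv : v ≠ 0) {g g' : ℝ → ℂ}
    (hg : ∀ x, HasDerivAt g (g' x) x) (h0 : Integrable g (gaussianReal 0 v))
    (h1 : Integrable g' (gaussianReal 0 v))
    (h2 : Integrable (fun x : ℝ => (x : ℂ) * g x) (gaussianReal 0 v)) :
    ∫ x : ℝ, (x : ℂ) * g x ∂gaussianReal 0 v = v * ∫ x, g' x ∂gaussianReal 0 v := by
  have hv' : (v : ℂ) ≠ 0 := by exact_mod_cast hv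
  rw [integrable_gaussianReal_iff hv] at h0 h1 h2
  rw [integral_gaussianReal_eq_integral_smul hv, integral_gaussianReal_eq_integral_smul hv]
  have hp : ∀ x, HasDerivAt (fun x => (gaussianPDFReal 0 v x : ℂ))
      ((-(x / v) * gaussianPDFReal 0 v x : ℝ) : ℂ) x := fun x =>
    (hasDerivAt_gaussianPDFReal hv x).ofReal_comp
  have h3 := integral_mul_deriv_eq_deriv_mul_of_integrable (u := g) (u' := g')
    (v := fun x => (gaussianPDFReal 0 v x : ℂ)) (fun x _ => hg x) (fun x _ => hp x)
    ((h2.const_mul (-(v : ℂ)⁻¹)).congr (ae_of_all _ fun x => ?_))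
    (h1.congr (ae_of_all _ fun x => mul_comm _ _)) (h0.congr (ae_of_all _ fun x => mul_comm _ _))
  · have h4 : ∀ x, g x * ((-(x / v) * gaussianPDFReal 0 v x : ℝ) : ℂ) =
        -(v : ℂ)⁻¹ * (gaussianPDFReal 0 v x • ((x : ℂ) * g x)) := fun x => by
      simp [Complex.real_smul]; field_simp
    have h5 : ∀ x, g' x * (gaussianPDFReal 0 v x : ℂ) = gaussianPDFReal 0 v x • g' x := fun x => by
      simp [Complex.real_smul, mul_comm]
    simp only [h4, h5, integral_const_mul] at h3
    have h6 := congrArg (fun z => -(v : ℂ) * z) h3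
    rw [← mul_assoc, neg_mul_neg, mul_inv_cancel₀ hv', one_mul, neg_mul_neg] at h6
    exact h6
  · simp; field_simp

variable {Ω : Type*} [MeasurableSpace Ω] {P : Measure Ω}
variable {E : Type*} [NormedAddCommGroup E] [NormedSpace ℝ E] [MeasurableSpace E] [BorelSpace E]
  [CompleteSpace E] [SecondCountableTopology E]

/-- Gaussian integration by parts: if `(X, R)` is a Gaussian vector and the real component `R` is
centered, then `E[R f(X)] = E[f'(X) c]` with `c = E[R X]`. The vector `X` is split into the part
`R c / E[R²]` and a remainder independent of `R`; conditionally on the remainder, the formula is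
the one-dimensional one. -/
theorem integral_mul_comp_gaussian {X : Ω → E} {R : Ω → ℝ}
    (hXR : HasGaussianLaw (fun ω => (X ω, R ω)) P) (hR : ∫ ω, R ω ∂P = 0) {f : E → ℂ}
    (hf : f.HasTemperateGrowth) :
    ∫ ω, (R ω : ℂ) * f (X ω) ∂P = ∫ ω, fderiv ℝ f (X ω) (∫ ω', R ω' • X ω' ∂P) ∂P := by
  have := hXR.isProbabilityMeasure
  have hX := hXR.fst
  have hRg := hXR.snd
  set c : E := ∫ ω', R ω' • X ω' ∂P with hc
  set v : ℝ≥0 := Var[R; P].toNNReal with hv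
  have hvar : (v : ℝ) = ∫ ω, R ω * R ω ∂P := by
    rw [hv, Real.coe_toNNReal _ (variance_nonneg _ _), variance_eq_sub hRg.memLp_two, hR]
    simp [pow_two]
  have hlaw : P.map R = gaussianReal 0 v := by rw [hRg.map_eq_gaussianReal, hR]
  by_cases hv0 : v = 0
  -- If `E[R²] = 0`, then `R = 0` almost surely, `c = 0`, and both sides vanish.
  · have hR0 : R =ᵐ[P] 0 := by
      have h1 : ∫ ω, R ω * R ω ∂P = 0 := by rw [← hvar, hv0]; simp
      rw [integral_eq_zero_iff_of_nonneg (fun ω => mul_self_nonneg _)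
        (hRg.memLp_two.integrable_mul hRg.memLp_two)] at h1
      filter_upwards [h1] with ω hω
      simpa using hω
    have hc0 : c = 0 := by
      rw [hc]
      refine integral_eq_zero_of_ae ?_
      filter_upwards [hR0] with ω hω
      simp [hω]
    rw [hc0]
    simp only [map_zero, integral_zero]
    refine integral_eq_zero_of_ae ?_
    filter_upwards [hR0] with ω hω
    simp [hω]
  · have hv' : (v : ℝ) ≠ 0 := by exact_mod_cast hv0
    set d : E := (v : ℝ)⁻¹ • c with hd
    let A : E × ℝ →L[ℝ] E × ℝ :=
      (ContinuousLinearMap.fst ℝ E ℝ - (ContinuousLinearMap.snd ℝ E ℝ).smulRight d).prod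
        (ContinuousLinearMap.snd ℝ E ℝ)
    set Y : Ω → E := fun ω => X ω - R ω • d with hY
    have hYR : HasGaussianLaw (fun ω => (Y ω, R ω)) P := hXR.map_fun A
    have hintRX : Integrable (fun ω => R ω • X ω) P :=
      memLp_one_iff_integrable.1 (hX.memLp_two.smul hRg.memLp_two)
    have hRR : Integrable (fun ω => R ω * R ω) P := hRg.memLp_two.integrable_mul hRg.memLp_two
    -- `d = c / E[R²]` makes `Y` and `R` uncorrelated; being jointly Gaussian, they are independent.
    have hind : IndepFun Y R P := by
      refine hYR.indepFun_of_covariance_strongDual fun L₁ L₂ => ?_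
      have h2 : ∀ r, L₂ r = r * L₂ 1 := fun r => by
        rw [← smul_eq_mul, ← map_smul]; simp
      have e1 : MemLp (L₁ ∘ Y) 2 P := (hYR.fst.map L₁).memLp_two
      have e2 : MemLp (L₂ ∘ R) 2 P := (hRg.map L₂).memLp_two
      rw [covariance_eq_sub e1 e2]
      have h3 : ∫ ω, (L₂ ∘ R) ω ∂P = 0 := by
        simp only [Function.comp_def, h2 (R _), integral_mul_const, hR, zero_mul]
      have h4 : ∫ ω, (L₁ ∘ Y * L₂ ∘ R) ω ∂P = 0 := by
        have h5 : ∀ ω, (L₁ ∘ Y * L₂ ∘ R) ω =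
            (L₁ (R ω • X ω) - (R ω * R ω) * L₁ d) * L₂ 1 := fun ω => by
          simp only [Pi.mul_apply, Function.comp_apply, hY, map_sub, map_smul, smul_eq_mul,
            h2 (R ω)]
          ring
        simp only [h5, integral_mul_const]
        rw [integral_sub (L₁.integrable_comp hintRX)
          (hRR.mul_const _), integral_mul_const,
          L₁.integral_comp_comm hintRX, ← hvar, ← hc, hd, map_smul, smul_eq_mul,
          mul_inv_cancel_left₀ hv', sub_self, zero_mul]
      rw [h4, h3, mul_zero, sub_zero]
    have hmap : P.map (fun ω => (Y ω, R ω)) = (P.map Y).prod (gaussianReal 0 v) := by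
      rw [← hlaw]
      exact hind.map_prod_eq_prod_map_map hYR.fst.aemeasurable hRg.aemeasurable
    have hprob : IsProbabilityMeasure (P.map Y) := Measure.isProbabilityMeasure_map
      hYR.fst.aemeasurable
    have hXY : ∀ ω, X ω = Y ω + R ω • d := fun ω => by simp [hY]
    have hcont : ∀ {g : E → ℂ}, Continuous g → ∀ {a : ℝ → ℂ}, Continuous a →
        Continuous fun q : E × ℝ => a q.2 * g (q.1 + q.2 • d) := fun hg a ha => by fun_prop
    -- Transfer of integrals and of integrability to the product law of `(Y, R)`.
    have htrans : ∀ {g : E → ℂ}, g.HasTemperateGrowth → ∀ {a : ℝ → ℂ}, a.HasTemperateGrowth →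
        Integrable (fun q : E × ℝ => a q.2 * g (q.1 + q.2 • d)) ((P.map Y).prod (gaussianReal 0 v)) ∧
        ∫ ω, a (R ω) * g (X ω) ∂P =
          ∫ y, ∫ r, a r * g (y + r • d) ∂gaussianReal 0 v ∂P.map Y := by
      intro g hg a ha
      have hm := (hcont hg.1.continuous ha.1.continuous).aestronglyMeasurable
        (μ := P.map (fun ω => (Y ω, R ω)))
      have hi : Integrable (fun q : E × ℝ => a q.2 * g (q.1 + q.2 • d))
          (P.map (fun ω => (Y ω, R ω))) := by
        rw [integrable_map_measure hm hYR.aemeasurable]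
        simp only [Function.comp_def, ← hXY]
        exact (memLp_comp_gaussian hRg ha (by simp : (2 : ℝ≥0∞) ≠ ∞)).integrable_mul
          (memLp_comp_gaussian hX hg (by simp : (2 : ℝ≥0∞) ≠ ∞))
      have he := integral_map hYR.aemeasurable hm
      simp only [← hXY] at he
      rw [hmap] at hi he
      refine ⟨hi, ?_⟩
      rw [← he, integral_prod _ hi]
    have hone : (fun _ : ℝ => (1 : ℂ)).HasTemperateGrowth := Function.HasTemperateGrowth.const 1
    have hid : (fun r : ℝ => (r : ℂ)).HasTemperateGrowth :=
      Function.Complex.hasTemperateGrowth_ofReal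
    have hfd := hasTemperateGrowth_fderiv_apply hf d
    obtain ⟨i1, j1⟩ := htrans hf hid
    obtain ⟨i2, -⟩ := htrans hf hone
    obtain ⟨i3, j3⟩ := htrans hfd hone
    have hcd : c = (v : ℝ) • d := by rw [hd, smul_inv_smul₀ hv']
    have hdiff : Differentiable ℝ f := hf.1.differentiable (by simp)
    rw [j1]
    simp only [hcd, map_smul, integral_smul]
    simp only [one_mul] at j3 i2 i3
    rw [j3, ← integral_smul]
    refine integral_congr_ae ?_
    filter_upwards [i1.prod_right_ae, i2.prod_right_ae, i3.prod_right_ae] with y h1 h2 h3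
    rw [integral_mul_gaussianReal hv0 (g := fun r => f (y + r • d)) (fun r => ?_) h2 h3 h1]
    · simp [Complex.real_smul]
    · have h4 : HasDerivAt (fun r : ℝ => y + r • d) d r := by
        simpa using ((hasDerivAt_id r).smul_const d).const_add y
      exact (hdiff _).hasFDerivAt.comp_hasDerivAt r h4

end Gaussian

/-! ### Wirtinger derivatives along vectors -/

section Wirtinger

variable {E F : Type*} [NormedAddCommGroup E] [NormedSpace ℂ E] [NormedAddCommGroup F]
  [NormedSpace ℂ F]

/-- The Wirtinger derivative `∂_v f = (f'(v) - i f'(iv)) / 2`, the `ℂ`-linear part of the real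
derivative of `f`; along the `i`-th unit vector it is `∂f/∂z_i`. -/
noncomputable def dz (f : E → ℂ) (z v : E) : ℂ :=
  (1 / 2) * (fderiv ℝ f z v - Complex.I * fderiv ℝ f z (Complex.I • v))

/-- The Wirtinger derivative `∂̄_v f = (f'(v) + i f'(iv)) / 2`, the antilinear part of the real
derivative of `f`; along the `i`-th unit vector it is `∂f/∂conj(z_i)`. -/
noncomputable def dzbar (f : E → ℂ) (z v : E) : ℂ :=
  (1 / 2) * (fderiv ℝ f z v + Complex.I * fderiv ℝ f z (Complex.I • v))

theorem dz_add_vec (f : E → ℂ) (z v w : E) : dz f z (v + w) = dz f z v + dz f z w := by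
  simp only [dz, smul_add, map_add]
  ring

theorem dz_smul_vec (f : E → ℂ) (z : E) (c : ℂ) (v : E) : dz f z (c • v) = c * dz f z v := by
  have h1 : c • v = c.re • v + c.im • (Complex.I • v) := by
    conv_lhs => rw [← Complex.re_add_im c]
    rw [add_smul, mul_smul, Complex.coe_smul, Complex.coe_smul]
  have h2 : Complex.I • c • v = c.re • (Complex.I • v) - c.im • v := by
    rw [h1, smul_add, smul_comm Complex.I c.re, smul_comm Complex.I c.im, smul_smul Complex.I,
      Complex.I_mul_I, neg_smul, one_smul, smul_neg, sub_eq_add_neg]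
  rw [dz, dz, h2, h1]
  simp only [map_add, map_sub, map_smul, Complex.real_smul]
  conv_rhs => rw [← Complex.re_add_im c]
  linear_combination (1 / 2 : ℂ) * (c.im * fderiv ℝ f z (Complex.I • v)) * Complex.I_sq

theorem dz_sum_vec {κ : Type*} (s : Finset κ) (f : E → ℂ) (z : E) (v : κ → E) :
    dz f z (∑ i ∈ s, v i) = ∑ i ∈ s, dz f z (v i) := by
  classical
  induction s using Finset.induction_on with
  | empty => simp [dz]
  | insert a s ha ih => rw [Finset.sum_insert ha, Finset.sum_insert ha, dz_add_vec, ih]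

theorem dz_pi {κ : Type*} [Fintype κ] [DecidableEq κ] (f : (κ → ℂ) → ℂ) (z v : κ → ℂ) :
    dz f z v = ∑ i, v i * dz f z (Pi.single i 1) := by
  conv_lhs => rw [pi_eq_sum_univ' v, dz_sum_vec]
  refine Finset.sum_congr rfl fun i _ => ?_
  rw [dz_smul_vec]

theorem dz_mul {f g : E → ℂ} (hf : Differentiable ℝ f) (hg : Differentiable ℝ g) (z v : E) :
    dz (fun x => f x * g x) z v = f z * dz g z v + g z * dz f z v := by
  rw [dz, dz, dz, fderiv_fun_mul (hf z) (hg z)]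
  simp only [_root_.add_apply, _root_.smul_apply, smul_eq_mul]
  ring

theorem dzbar_mul {f g : E → ℂ} (hf : Differentiable ℝ f) (hg : Differentiable ℝ g) (z v : E) :
    dzbar (fun x => f x * g x) z v = f z * dzbar g z v + g z * dzbar f z v := by
  rw [dzbar, dzbar, dzbar, fderiv_fun_mul (hf z) (hg z)]
  simp only [_root_.add_apply, _root_.smul_apply, smul_eq_mul]
  ring

theorem dz_sum {κ : Type*} (s : Finset κ) {f : κ → E → ℂ} (hf : ∀ i, Differentiable ℝ (f i))
    (c : κ → ℂ) (z v : E) :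
    dz (fun x => ∑ i ∈ s, c i * f i x) z v = ∑ i ∈ s, c i * dz (f i) z v := by
  have h : fderiv ℝ (fun x => ∑ i ∈ s, c i * f i x) z = ∑ i ∈ s, c i • fderiv ℝ (f i) z := by
    rw [fderiv_fun_sum fun i _ => ((hf i z).const_mul (c i))]
    exact Finset.sum_congr rfl fun i _ => fderiv_const_mul (hf i z) (c i)
  simp only [dz, h, _root_.sum_apply, _root_.smul_apply, smul_eq_mul, Finset.mul_sum,
    ← Finset.sum_sub_distrib]
  exact Finset.sum_congr rfl fun i _ => by ring

theorem dzbar_sum {κ : Type*} (s : Finset κ) {f : κ → E → ℂ} (hf : ∀ i, Differentiable ℝ (f i))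
    (c : κ → ℂ) (z v : E) :
    dzbar (fun x => ∑ i ∈ s, c i * f i x) z v = ∑ i ∈ s, c i * dzbar (f i) z v := by
  have h : fderiv ℝ (fun x => ∑ i ∈ s, c i * f i x) z = ∑ i ∈ s, c i • fderiv ℝ (f i) z := by
    rw [fderiv_fun_sum fun i _ => ((hf i z).const_mul (c i))]
    exact Finset.sum_congr rfl fun i _ => fderiv_const_mul (hf i z) (c i)
  simp only [dzbar, h, _root_.sum_apply, _root_.smul_apply, smul_eq_mul, Finset.mul_sum,
    ← Finset.sum_add_distrib]
  exact Finset.sum_congr rfl fun i _ => by ring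

theorem fderiv_conj {f : E → ℂ} {z : E} (hf : DifferentiableAt ℝ f z) (v : E) :
    fderiv ℝ (fun x => starRingEnd ℂ (f x)) z v = starRingEnd ℂ (fderiv ℝ f z v) := by
  have h := Complex.conjCLE.toContinuousLinearMap.hasFDerivAt.comp z hf.hasFDerivAt
  have h2 := h.fderiv
  have h3 : (⇑(Complex.conjCLE.toContinuousLinearMap) ∘ f) = fun x => starRingEnd ℂ (f x) := by
    funext x; simp
  rw [h3] at h2
  rw [h2]
  simp

theorem dzbar_conj {f : E → ℂ} (hf : Differentiable ℝ f) (z v : E) :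
    dzbar (fun x => starRingEnd ℂ (f x)) z v = starRingEnd ℂ (dz f z v) := by
  rw [dzbar, dz, fderiv_conj (hf z), fderiv_conj (hf z)]
  simp [map_ofNat]

theorem dz_conj {f : E → ℂ} (hf : Differentiable ℝ f) (z v : E) :
    dz (fun x => starRingEnd ℂ (f x)) z v = starRingEnd ℂ (dzbar f z v) := by
  rw [dzbar, dz, fderiv_conj (hf z), fderiv_conj (hf z)]
  simp [sub_eq_add_neg, map_ofNat]

theorem dz_comp_clm {f : F → ℂ} (hf : Differentiable ℝ f) (L : E →L[ℂ] F) (z v : E) :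
    dz (fun x => f (L x)) z v = dz f (L z) (L v) := by
  have h := ((hf (L z)).hasFDerivAt.comp z (L.restrictScalars ℝ).hasFDerivAt).fderiv
  have h2 : ∀ w, fderiv ℝ (fun x => f (L x)) z w = fderiv ℝ f (L z) (L w) := fun w =>
    congrArg (fun A => A w) h
  rw [dz, dz, h2, h2, map_smul]

theorem hasTemperateGrowth_dz {f : E → ℂ} (hf : f.HasTemperateGrowth) (v : E) :
    (fun z => dz f z v).HasTemperateGrowth :=
  (Function.HasTemperateGrowth.const _).fun_mul ((hasTemperateGrowth_fderiv_apply hf v).fun_sub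
    ((Function.HasTemperateGrowth.const _).fun_mul (hasTemperateGrowth_fderiv_apply hf _)))

theorem hasTemperateGrowth_dzbar {f : E → ℂ} (hf : f.HasTemperateGrowth) (v : E) :
    (fun z => dzbar f z v).HasTemperateGrowth :=
  (Function.HasTemperateGrowth.const _).fun_mul ((hasTemperateGrowth_fderiv_apply hf v).fun_add
    ((Function.HasTemperateGrowth.const _).fun_mul (hasTemperateGrowth_fderiv_apply hf _)))

theorem hasTemperateGrowth_comp_clm {f : F → ℂ} (hf : f.HasTemperateGrowth) (L : E →L[ℂ] F) :
    (fun x => f (L x)).HasTemperateGrowth :=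
  hf.comp (L.restrictScalars ℝ).hasTemperateGrowth

theorem _root_.Function.HasTemperateGrowth.differentiable {f : E → ℂ}
    (hf : f.HasTemperateGrowth) : Differentiable ℝ f :=
  hf.1.differentiable (by simp)

theorem wirtinger_eq_dz {k : ℕ} (f : (Fin k → ℂ) → ℂ) (i : Fin k) (z : Fin k → ℂ) :
    wirtinger f i z = dz f z (Pi.single i 1) := by
  rw [wirtinger, dz, ← Pi.single_smul, smul_eq_mul, mul_one]

theorem wirtingerBar_eq_dzbar {k : ℕ} (f : (Fin k → ℂ) → ℂ) (i : Fin k) (z : Fin k → ℂ) :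
    wirtingerBar f i z = dzbar f z (Pi.single i 1) := by
  rw [wirtingerBar, dzbar, ← Pi.single_smul, smul_eq_mul, mul_one]

end Wirtinger

/-! ### Integration by parts for an isonormal process -/

section Isonormal

variable {Ω : Type*} [MeasurableSpace Ω] {P : Measure Ω} {H : Type*} [NormedAddCommGroup H]
  [InnerProductSpace ℂ H] {Z : H → Ω → ℂ}

theorem IsIsonormal.memLp [IsProbabilityMeasure P] (hZ : IsIsonormal Z P) (h : H) :
    MemLp (Z h) 2 P :=
  (hZ.gaussian.hasGaussianLaw_eval h).memLp_two

/-- An isonormal process is additive, since the second moment of the defect vanishes. -/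
theorem IsIsonormal.add_ae [IsProbabilityMeasure P] (hZ : IsIsonormal Z P) (g h : H) :
    Z (g + h) =ᵐ[P] fun ω => Z g ω + Z h ω := by
  let ζ : H → Lp ℂ 2 P := fun x => (hZ.memLp x).toLp (Z x)
  have hζ : ∀ x y, ⟪ζ x, ζ y⟫_ℂ = ⟪x, y⟫_ℂ := fun x y => by
    rw [L2.inner_def, ← hZ.covariance]
    refine integral_congr_ae ?_
    filter_upwards [(hZ.memLp x).coeFn_toLp, (hZ.memLp y).coeFn_toLp] with ω h1 h2
    rw [h1, h2, RCLike.inner_apply]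
  have h0 : ζ (g + h) - (ζ g + ζ h) = 0 := by
    rw [← inner_self_eq_zero (𝕜 := ℂ)]
    simp only [inner_sub_left, inner_sub_right, inner_add_left, inner_add_right, hζ]
    ring
  have h1 : ζ (g + h) = ζ g + ζ h := sub_eq_zero.1 h0
  have h2 : (ζ (g + h) : Ω → ℂ) =ᵐ[P] (ζ g + ζ h : Lp ℂ 2 P) := by rw [h1]
  filter_upwards [h2, Lp.coeFn_add (ζ g) (ζ h), (hZ.memLp (g + h)).coeFn_toLp,
    (hZ.memLp g).coeFn_toLp, (hZ.memLp h).coeFn_toLp] with ω a1 a2 a3 a4 a5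
  rw [← a3, ← a4, ← a5]
  exact a1.trans a2

theorem IsIsonormal.integral_mul [IsProbabilityMeasure P] (hZ : IsIsonormal Z P) (g h : H) :
    ∫ ω, Z g ω * Z h ω ∂P = 0 := by
  have h1 := hZ.symmetric (g + h)
  have i1 : ∀ x y, Integrable (fun ω => Z x ω * Z y ω) P := fun x y =>
    (hZ.memLp x).integrable_mul (hZ.memLp y)
  have h2 : ∫ ω, Z (g + h) ω ^ 2 ∂P =
      ∫ ω, (Z g ω * Z g ω + Z h ω * Z h ω + 2 * (Z g ω * Z h ω)) ∂P := by
    refine integral_congr_ae ?_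
    filter_upwards [hZ.add_ae g h] with ω hω
    rw [hω]
    ring
  have i2 : Integrable (fun ω => Z g ω * Z g ω + Z h ω * Z h ω) P := (i1 g g).add (i1 h h)
  rw [h2, integral_add i2 ((i1 g h).const_mul 2), integral_add (i1 g g)
    (i1 h h), integral_const_mul] at h1
  have h3 := hZ.symmetric g
  have h4 := hZ.symmetric h
  simp only [pow_two] at h3 h4
  rw [h3, h4] at h1
  simpa using h1

variable {κ : Type*} [Fintype κ]

theorem IsIsonormal.hasGaussianLaw_pi_prod (hZ : IsIsonormal Z P) (φ : κ → H) (h : H) :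
    HasGaussianLaw (fun ω => ((fun i => Z (φ i) ω), Z h ω)) P := by
  let ψ : Option κ → H := fun o => o.elim h φ
  have h1 := (hZ.gaussian.comp_right ψ).hasGaussianLaw Finset.univ
  let L : ({o // o ∈ (Finset.univ : Finset (Option κ))} → ℂ) →L[ℝ] (κ → ℂ) × ℂ :=
    (ContinuousLinearMap.pi fun i => ContinuousLinearMap.proj ⟨some i, Finset.mem_univ _⟩).prod
      (ContinuousLinearMap.proj ⟨none, Finset.mem_univ _⟩)
  exact h1.map_fun L

theorem IsIsonormal.hasGaussianLaw_pi (hZ : IsIsonormal Z P) (φ : κ → H) :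
    HasGaussianLaw (fun ω i => Z (φ i) ω) P :=
  (hZ.hasGaussianLaw_pi_prod φ 0).fst

theorem IsIsonormal.memLp_comp (hZ : IsIsonormal Z P) (φ : κ → H) {f : (κ → ℂ) → ℂ}
    (hf : f.HasTemperateGrowth) : MemLp (fun ω => f fun i => Z (φ i) ω) 2 P :=
  memLp_comp_gaussian (hZ.hasGaussianLaw_pi φ) hf (by simp)

theorem IsIsonormal.integrable_comp (hZ : IsIsonormal Z P) (φ : κ → H) {f : (κ → ℂ) → ℂ}
    (hf : f.HasTemperateGrowth) : Integrable (fun ω => f fun i => Z (φ i) ω) P :=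
  memLp_one_iff_integrable.1 (memLp_comp_gaussian (hZ.hasGaussianLaw_pi φ) hf (by simp))

/-- Integration by parts against the real and imaginary parts of `Z h`. -/
theorem IsIsonormal.integral_re_im_mul [IsProbabilityMeasure P] (hZ : IsIsonormal Z P) (φ : κ → H)
    (h : H) {f : (κ → ℂ) → ℂ} (hf : f.HasTemperateGrowth) :
    (∫ ω, ((Z h ω).re : ℂ) * f (fun i => Z (φ i) ω) ∂P =
      (1 / 2) * ∫ ω, fderiv ℝ f (fun i => Z (φ i) ω) (fun i => ⟪h, φ i⟫_ℂ) ∂P) ∧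
    ∫ ω, ((Z h ω).im : ℂ) * f (fun i => Z (φ i) ω) ∂P =
      (1 / 2) * ∫ ω, fderiv ℝ f (fun i => Z (φ i) ω)
        (Complex.I • fun i => ⟪h, φ i⟫_ℂ) ∂P := by
  have hG := hZ.hasGaussianLaw_pi_prod φ h
  have hX := hZ.hasGaussianLaw_pi φ
  have hi := (hZ.memLp h).integrable (by norm_num)
  have hcc : ∀ i, Integrable (fun ω => Z (φ i) ω * starRingEnd ℂ (Z h ω)) P := fun i =>
    (hZ.memLp (φ i)).integrable_mul (hZ.memLp h).star
  have hci : ∀ i, Integrable (fun ω => Z (φ i) ω * Z h ω) P := fun i =>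
    (hZ.memLp (φ i)).integrable_mul (hZ.memLp h)
  have key : ∀ (L : ℂ →L[ℝ] ℝ) (a b : ℂ),
      (∀ z, ((L z : ℝ) : ℂ) = a * z + b * starRingEnd ℂ z) →
      ∫ ω, ((L (Z h ω) : ℝ) : ℂ) * f (fun i => Z (φ i) ω) ∂P =
        ∫ ω, fderiv ℝ f (fun i => Z (φ i) ω) (b • fun i => ⟪h, φ i⟫_ℂ) ∂P := by
    intro L a b hL
    have hXR : HasGaussianLaw (fun ω => ((fun i => Z (φ i) ω), L (Z h ω))) P :=
      hG.map_fun ((ContinuousLinearMap.fst ℝ (κ → ℂ) ℂ).prod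
        (L.comp (ContinuousLinearMap.snd ℝ (κ → ℂ) ℂ)))
    have hR : ∫ ω, L (Z h ω) ∂P = 0 := by
      rw [L.integral_comp_comm hi, hZ.centered, map_zero]
    rw [integral_mul_comp_gaussian hXR hR hf]
    congr 1
    funext ω
    congr 1
    have hint : Integrable (fun ω => L (Z h ω) • fun i => Z (φ i) ω) P :=
      memLp_one_iff_integrable.1 (hX.memLp_two.smul hXR.snd.memLp_two)
    funext i
    have h1 := (ContinuousLinearMap.proj (R := ℝ) (φ := fun _ : κ => ℂ) i).integral_comp_comm hint
    simp only [ContinuousLinearMap.proj_apply] at h1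
    rw [← h1]
    have h2 : ∀ ω, (L (Z h ω) • fun i => Z (φ i) ω) i =
        a * (Z (φ i) ω * Z h ω) + b * (Z (φ i) ω * starRingEnd ℂ (Z h ω)) := fun ω => by
      rw [Pi.smul_apply, Complex.real_smul, hL]
      ring
    simp only [h2]
    rw [integral_add ((hci i).const_mul _) ((hcc i).const_mul _), integral_const_mul,
      integral_const_mul, hZ.integral_mul, hZ.covariance]
    simp
  constructor
  · have h1 := key Complex.reCLM (1 / 2) (1 / 2) fun z => by
      rw [Complex.reCLM_apply, Complex.re_eq_add_conj]; ring
    have h2 : ((1 / 2 : ℂ) • fun i => ⟪h, φ i⟫_ℂ) = (1 / 2 : ℝ) • fun i => ⟪h, φ i⟫_ℂ := by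
      funext i; simp
    simp only [h2, map_smul, integral_smul, Complex.reCLM_apply] at h1
    rw [h1]
    simp
  · have h1 := key Complex.imCLM (1 / (2 * Complex.I)) (Complex.I / 2) fun z => by
      rw [Complex.imCLM_apply, Complex.im_eq_sub_conj]
      field_simp
      linear_combination (-starRingEnd ℂ z) * Complex.I_sq
    have h2 : ((Complex.I / 2 : ℂ) • fun i => ⟪h, φ i⟫_ℂ) =
        (1 / 2 : ℝ) • (Complex.I • fun i => ⟪h, φ i⟫_ℂ) := by
      funext i; simp; ring
    simp only [h2, map_smul, integral_smul, Complex.imCLM_apply] at h1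
    rw [h1]
    simp

/-- Integration by parts against `conj (Z h)` produces the Wirtinger derivative `∂`. -/
theorem IsIsonormal.integral_mul_conj [IsProbabilityMeasure P] (hZ : IsIsonormal Z P) (φ : κ → H)
    (h : H) {f : (κ → ℂ) → ℂ} (hf : f.HasTemperateGrowth) :
    ∫ ω, f (fun i => Z (φ i) ω) * starRingEnd ℂ (Z h ω) ∂P =
      ∫ ω, dz f (fun i => Z (φ i) ω) (fun i => ⟪h, φ i⟫_ℂ) ∂P := by
  obtain ⟨h1, h2⟩ := hZ.integral_re_im_mul φ h hf
  have i1 : Integrable (fun ω => ((Z h ω).re : ℂ) * f (fun i => Z (φ i) ω)) P :=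
    (hZ.memLp h).re.ofReal.integrable_mul (hZ.memLp_comp φ hf)
  have i2 : Integrable (fun ω => ((Z h ω).im : ℂ) * f (fun i => Z (φ i) ω)) P :=
    (hZ.memLp h).im.ofReal.integrable_mul (hZ.memLp_comp φ hf)
  have j := fun v => hZ.integrable_comp φ (hasTemperateGrowth_fderiv_apply hf v)
  have h3 : ∀ ω, f (fun i => Z (φ i) ω) * starRingEnd ℂ (Z h ω) =
      ((Z h ω).re : ℂ) * f (fun i => Z (φ i) ω) -
        Complex.I * (((Z h ω).im : ℂ) * f (fun i => Z (φ i) ω)) := fun ω => by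
    have : starRingEnd ℂ (Z h ω) = (Z h ω).re - (Z h ω).im * Complex.I := by
      apply Complex.ext <;> simp
    rw [this]
    ring
  simp only [h3, dz]
  rw [integral_sub i1 (i2.const_mul _), integral_const_mul, h1, h2, integral_const_mul,
    integral_sub (j _) ((j _).const_mul _), integral_const_mul]
  ring

/-- Integration by parts against `Z h` produces the Wirtinger derivative `∂̄`. -/
theorem IsIsonormal.integral_mul_self [IsProbabilityMeasure P] (hZ : IsIsonormal Z P) (φ : κ → H)
    (h : H) {f : (κ → ℂ) → ℂ} (hf : f.HasTemperateGrowth) :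
    ∫ ω, f (fun i => Z (φ i) ω) * Z h ω ∂P =
      ∫ ω, dzbar f (fun i => Z (φ i) ω) (fun i => ⟪h, φ i⟫_ℂ) ∂P := by
  have h1 := hZ.integral_mul_conj φ h (hasTemperateGrowth_conj hf)
  have h2 := congrArg (starRingEnd ℂ) h1
  rw [← integral_conj, ← integral_conj] at h2
  simpa [dz_conj hf.differentiable] using h2

end Isonormal

/-! ### Closability of the Malliavin derivative -/

section Closability

variable {Ω : Type*} [MeasurableSpace Ω] {P : Measure Ω} {H : Type*} [NormedAddCommGroup H]
  [InnerProductSpace ℂ H] {Z : H → Ω → ℂ}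

theorem forall_mem_closure {X : Type*} [TopologicalSpace X] {s : Set X} {p : X → Prop}
    (hs : ∀ x ∈ s, p x) (hp : IsClosed {x | p x}) : ∀ x ∈ closure s, p x :=
  fun _ hx => closure_minimal (t := {x | p x}) (fun x hx => hs x hx) hp hx

/-- The map `G ↦ ⟨G, h⟩` from `L²(Ω; H)` to `L²(Ω)`. -/
noncomputable def innerLp (P : Measure Ω) (h : H) : Lp H 2 P →L[ℂ] Lp ℂ 2 P :=
  (innerSL ℂ h).compLpL 2 P

theorem coeFn_innerLp (h : H) (G : Lp H 2 P) : innerLp P h G =ᵐ[P] fun ω => ⟪h, G ω⟫_ℂ :=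
  (innerSL ℂ h).coeFn_compLpL G

theorem inner_sum_dz {k : ℕ} (φ : Fin k → H) (f : (Fin k → ℂ) → ℂ) (z : Fin k → ℂ) (h : H) :
    ⟪h, ∑ i, wirtinger f i z • φ i⟫_ℂ = dz f z fun i => ⟪h, φ i⟫_ℂ := by
  rw [dz_pi, inner_sum]
  refine Finset.sum_congr rfl fun i _ => ?_
  rw [inner_smul_right, wirtinger_eq_dz, mul_comm]

/-- The duality behind closability: against a smooth test variable `T`, the pairing of `⟨D F, h⟩`
with `T` is the pairing of `F` with a fixed square integrable variable, namely
`T Z(h) - conj ⟨D (conj T), h⟩`. -/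
theorem IsIsonormal.exists_inner_eq [IsProbabilityMeasure P] (hZ : IsIsonormal Z P) (h : H)
    {k : ℕ} (ψ : Fin k → H) {g : (Fin k → ℂ) → ℂ} (hg : g.HasTemperateGrowth) :
    ∃ s : Lp ℂ 2 P, ∀ t : Lp ℂ 2 P, (t : Ω → ℂ) =ᵐ[P] (fun ω => g fun i => Z (ψ i) ω) →
      ∀ p ∈ smoothGraph P Z, ⟪t, innerLp P h p.2⟫_ℂ = ⟪s, p.1⟫_ℂ := by
  have hgc := hasTemperateGrowth_conj hg
  have hdg := hasTemperateGrowth_dz hgc fun i => ⟪h, ψ i⟫_ℂ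
  have hm1 : MemLp (fun ω => g (fun i => Z (ψ i) ω) * Z h ω) 2 P :=
    memLp_comp_gaussian (hZ.hasGaussianLaw_pi_prod ψ h)
      (f := fun q : (Fin k → ℂ) × ℂ => g q.1 * q.2)
      ((hasTemperateGrowth_comp_clm hg (ContinuousLinearMap.fst ℂ _ _)).fun_mul
        (ContinuousLinearMap.snd ℝ (Fin k → ℂ) ℂ).hasTemperateGrowth) (by simp)
  have hm2 := hZ.memLp_comp ψ (hasTemperateGrowth_conj hdg)
  refine ⟨(hm1.sub hm2).toLp _, fun t ht p hp => ?_⟩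
  obtain ⟨k', φ, f, hf, h1, h2⟩ := hp
  let χ : Fin k' ⊕ Fin k → H := Sum.elim φ ψ
  let A : (Fin k' ⊕ Fin k → ℂ) →L[ℂ] (Fin k' → ℂ) :=
    ContinuousLinearMap.pi fun i => ContinuousLinearMap.proj (Sum.inl i)
  let B : (Fin k' ⊕ Fin k → ℂ) →L[ℂ] (Fin k → ℂ) :=
    ContinuousLinearMap.pi fun i => ContinuousLinearMap.proj (Sum.inr i)
  have hfA := hasTemperateGrowth_comp_clm hf A
  have hgB := hasTemperateGrowth_comp_clm hgc B
  have hIBP := hZ.integral_mul_conj χ h (hfA.fun_mul hgB)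
  simp only [dz_mul hfA.differentiable hgB.differentiable, dz_comp_clm hf.differentiable,
    dz_comp_clm hgc.differentiable] at hIBP
  have i1 : Integrable (fun ω => f (fun i => Z (φ i) ω) *
      dz (fun x => starRingEnd ℂ (g x)) (fun i => Z (ψ i) ω) fun i => ⟪h, ψ i⟫_ℂ) P :=
    (hZ.memLp_comp φ hf).integrable_mul (hZ.memLp_comp ψ hdg)
  have i2 : Integrable (fun ω => starRingEnd ℂ (g fun i => Z (ψ i) ω) *
      dz f (fun i => Z (φ i) ω) fun i => ⟪h, φ i⟫_ℂ) P :=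
    (hZ.memLp_comp ψ hgc).integrable_mul (hZ.memLp_comp φ (hasTemperateGrowth_dz hf _))
  have i3 : Integrable (fun ω => f (fun i => Z (φ i) ω) *
      starRingEnd ℂ (g (fun i => Z (ψ i) ω) * Z h ω)) P :=
    (hZ.memLp_comp φ hf).integrable_mul hm1.star
  have e : ∫ ω, (f (fun i => Z (φ i) ω) * dz (fun x => starRingEnd ℂ (g x))
        (fun i => Z (ψ i) ω) fun i => ⟪h, ψ i⟫_ℂ) + (starRingEnd ℂ (g fun i => Z (ψ i) ω) *
          dz f (fun i => Z (φ i) ω) fun i => ⟪h, φ i⟫_ℂ) ∂P =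
      ∫ ω, f (fun i => Z (φ i) ω) * starRingEnd ℂ (g (fun i => Z (ψ i) ω) * Z h ω) ∂P := by
    refine Eq.trans hIBP.symm (integral_congr_ae (ae_of_all _ fun ω => ?_))
    simp only [map_mul]
    exact mul_assoc _ _ _
  rw [integral_add i1 i2] at e
  have e1 : ⟪t, innerLp P h p.2⟫_ℂ = ∫ ω, (starRingEnd ℂ (g fun i => Z (ψ i) ω) *
      dz f (fun i => Z (φ i) ω) fun i => ⟪h, φ i⟫_ℂ) ∂P := by
    rw [L2.inner_def]
    refine integral_congr_ae ?_
    filter_upwards [ht, coeFn_innerLp h p.2, h2] with ω a1 a2 a3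
    rw [a1, a2, a3, inner_sum_dz, RCLike.inner_apply, mul_comm]
  have e2 : ⟪(hm1.sub hm2).toLp _, p.1⟫_ℂ =
      ∫ ω, (f (fun i => Z (φ i) ω) * starRingEnd ℂ (g (fun i => Z (ψ i) ω) * Z h ω) -
        f (fun i => Z (φ i) ω) * dz (fun x => starRingEnd ℂ (g x))
        (fun i => Z (ψ i) ω) fun i => ⟪h, ψ i⟫_ℂ) ∂P := by
    rw [L2.inner_def]
    refine integral_congr_ae ?_
    filter_upwards [(hm1.sub hm2).coeFn_toLp, h1] with ω a1 a2
    rw [a1, a2, RCLike.inner_apply, Pi.sub_apply, map_sub, Complex.conj_conj, mul_sub]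
  rw [e1, e2, integral_sub i3 i1, ← e]
  ring

/-- The Malliavin derivative is closable: the closed graph attaches at most one value to each
variable. If `K` is the difference of two values, then `⟨K, h⟩` is orthogonal to every smooth
variable, and it is itself a limit of such variables. -/
theorem IsIsonormal.inGraphD_unique [IsProbabilityMeasure P] [TopologicalSpace.SeparableSpace H]
    (hZ : IsIsonormal Z P) {F : Lp ℂ 2 P} {G₁ G₂ : Lp H 2 P} (h₁ : InGraphD P Z F G₁)
    (h₂ : InGraphD P Z F G₂) : G₁ = G₂ := by
  have : SecondCountableTopology H := UniformSpace.secondCountable_of_separable H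
  have key : ∀ h : H, innerLp P h (G₁ - G₂) = 0 := by
    intro h
    -- `⟨D F', h⟩` is itself smooth for smooth `F'`, so it serves as a test variable.
    have hort : ∀ p ∈ smoothGraph P Z, ⟪innerLp P h p.2, innerLp P h (G₁ - G₂)⟫_ℂ = 0 := by
      rintro p ⟨k, φ, f, hf, -, hp2⟩
      obtain ⟨s, hs⟩ := hZ.exists_inner_eq h φ (hasTemperateGrowth_dz hf fun i => ⟪h, φ i⟫_ℂ)
      have hs' := hs (innerLp P h p.2) (by
        filter_upwards [coeFn_innerLp h p.2, hp2] with ω a1 a2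
        rw [a1, a2, inner_sum_dz])
      have hcl : ∀ q ∈ closure (smoothGraph P Z),
          ⟪innerLp P h p.2, innerLp P h q.2⟫_ℂ = ⟪s, q.1⟫_ℂ :=
        forall_mem_closure hs' (isClosed_eq (by fun_prop) (by fun_prop))
      rw [map_sub, inner_sub_right, hcl _ h₁, hcl _ h₂, sub_self]
    have hcl : ∀ q ∈ closure (smoothGraph P Z),
        ⟪innerLp P h q.2, innerLp P h (G₁ - G₂)⟫_ℂ = 0 :=
      forall_mem_closure hort (isClosed_eq (by fun_prop) (by fun_prop))
    rw [← inner_self_eq_zero (𝕜 := ℂ)]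
    conv_lhs => rw [map_sub (innerLp P h) G₁ G₂, inner_sub_left, ← map_sub]
    rw [hcl _ h₁, hcl _ h₂, sub_self]
  rw [← sub_eq_zero]
  refine (Lp.eq_zero_iff_ae_eq_zero).2 (ae_eq_zero_of_forall_inner (𝕜 := ℂ) fun h => ?_)
  refine (coeFn_innerLp h (G₁ - G₂)).symm.trans ?_
  rw [key h]
  exact Lp.coeFn_zero ℂ 2 P

/-- Membership in the graph of `D`, for smooth functions on `κ → ℂ` with any finite index set. -/
theorem mem_smoothGraph {κ : Type*} [Fintype κ] [DecidableEq κ] (φ : κ → H) {f : (κ → ℂ) → ℂ}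
    (hf : f.HasTemperateGrowth) {p : Lp ℂ 2 P × Lp H 2 P}
    (h1 : (p.1 : Ω → ℂ) =ᵐ[P] fun ω => f fun i => Z (φ i) ω)
    (h2 : (p.2 : Ω → H) =ᵐ[P] fun ω => ∑ i, dz f (fun i => Z (φ i) ω) (Pi.single i 1) • φ i) :
    p ∈ smoothGraph P Z := by
  let e := Fintype.equivFin κ
  let A : (Fin (Fintype.card κ) → ℂ) →L[ℂ] (κ → ℂ) :=
    ContinuousLinearMap.pi fun i => ContinuousLinearMap.proj (e i)
  refine ⟨Fintype.card κ, fun j => φ (e.symm j), fun z => f (A z),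
    hasTemperateGrowth_comp_clm hf A, ?_, ?_⟩
  · filter_upwards [h1] with ω hω
    rw [hω]
    congr 1
    funext i
    simp [A]
  · filter_upwards [h2] with ω hω
    rw [hω, ← e.sum_comp]
    refine Finset.sum_congr rfl fun i _ => ?_
    rw [wirtinger_eq_dz, dz_comp_clm hf.differentiable]
    have a1 : A (fun j => Z (φ (e.symm j)) ω) = fun i => Z (φ i) ω := by
      funext i; simp [A]
    have a2 : A (Pi.single (e i) 1) = Pi.single i 1 := by
      funext j; simp [A, Pi.single_apply]
    rw [a1, a2, Equiv.symm_apply_apply]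

end Closability

/-! ### Recurrences and derivatives of the complex Hermite polynomials -/

section Hermite

theorem hermiteJ_eq_sum {p q N : ℕ} (hN : min p q + 1 ≤ N) (z : ℂ) (ρ : ℝ) :
    hermiteJ p q z ρ = ∑ r ∈ Finset.range N, (-1) ^ r * (r.factorial : ℂ) * (p.choose r : ℂ) *
      (q.choose r : ℂ) * z ^ (p - r) * (starRingEnd ℂ z) ^ (q - r) * (ρ : ℂ) ^ r := by
  rw [hermiteJ]
  refine Finset.sum_subset (Finset.range_mono hN) fun r _ hr => ?_
  rw [Finset.mem_range, not_lt] at hr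
  rcases le_total p q with h | h
  · rw [Nat.choose_eq_zero_of_lt (n := p) (by omega)]; simp
  · rw [Nat.choose_eq_zero_of_lt (n := q) (by omega)]; simp

theorem hermiteJ_conj (p q : ℕ) (z : ℂ) (ρ : ℝ) :
    starRingEnd ℂ (hermiteJ p q z ρ) = hermiteJ q p z ρ := by
  rw [hermiteJ, hermiteJ, map_sum, min_comm]
  refine Finset.sum_congr rfl fun r _ => ?_
  simp only [map_mul, map_pow, map_neg, map_one, map_natCast, Complex.conj_conj, Complex.conj_ofReal]
  ring

/-- Homogeneity: rescaling the variable by `√2` doubles the parameter. -/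
theorem hermiteJ_sqrt_two_mul (p q : ℕ) (z : ℂ) :
    hermiteJ p q (((√2 : ℝ) : ℂ) * z) 2 = ((√2 : ℝ) : ℂ) ^ (p + q) * hermiteJ p q z 1 := by
  have h2 : ((2 : ℝ) : ℂ) = ((√2 : ℝ) : ℂ) ^ 2 := by
    rw [← Complex.ofReal_pow, Real.sq_sqrt (by norm_num)]
  rw [hermiteJ, hermiteJ, Finset.mul_sum]
  refine Finset.sum_congr rfl fun r hr => ?_
  have hr' : r ≤ min p q := Nat.lt_succ_iff.1 (Finset.mem_range.1 hr)
  have hp : p + q = (p - r) + (q - r) + 2 * r := by omega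
  rw [h2, hp, map_mul, Complex.conj_ofReal, mul_pow, mul_pow, ← pow_mul, pow_add, pow_add]
  simp
  ring

theorem hermiteJ_zero_left (q : ℕ) (z : ℂ) (ρ : ℝ) :
    hermiteJ 0 q z ρ = (starRingEnd ℂ z) ^ q := by
  simp [hermiteJ]

theorem hermiteJ_succ_left (p q : ℕ) (z : ℂ) :
    hermiteJ (p + 1) q z 1 = z * hermiteJ p q z 1 - q * hermiteJ p (q - 1) z 1 := by
  rw [hermiteJ_eq_sum (N := p + 2) (by omega), hermiteJ_eq_sum (p := p) (q := q) (N := p + 2)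
    (by omega), hermiteJ_eq_sum (p := p) (q := q - 1) (N := p + 1) (by omega),
    Finset.sum_range_succ', Finset.sum_range_succ' _ (p + 1), mul_add, Finset.mul_sum,
    Finset.mul_sum]
  have h0 : ∀ a b c : ℂ, a + b - c = (a - c) + b := fun a b c => by ring
  rw [h0, ← Finset.sum_sub_distrib]
  congr 1
  · refine Finset.sum_congr rfl fun r hr => ?_
    have hr' : r ≤ p := Nat.lt_succ_iff.1 (Finset.mem_range.1 hr)
    have h1 : (q : ℂ) * (r.factorial : ℂ) * ((q - 1).choose r : ℂ) =
        ((r + 1).factorial : ℂ) * (q.choose (r + 1) : ℂ) := by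
      rcases q with _ | q
      · simp
      · have h := Nat.add_one_mul_choose_eq q r
        rw [Nat.factorial_succ, Nat.add_sub_cancel]
        have h' : ((q + 1 : ℕ) : ℂ) * (q.choose r : ℂ) =
            ((q + 1).choose (r + 1) : ℂ) * ((r + 1 : ℕ) : ℂ) := by exact_mod_cast h
        push_cast at h' ⊢
        linear_combination (r.factorial : ℂ) * h'
    have h2 : (p.choose (r + 1) : ℂ) * (z * z ^ (p - (r + 1))) =
        (p.choose (r + 1) : ℂ) * z ^ (p - r) := by
      rcases hr'.lt_or_eq with h | h
      · rw [← pow_succ', show p - (r + 1) + 1 = p - r by omega]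
      · rw [h, Nat.choose_succ_self]; simp
    rw [Nat.choose_succ_succ, show p + 1 - (r + 1) = p - r by omega,
      show q - 1 - r = q - (r + 1) by omega]
    push_cast
    simp only [one_pow, mul_one, pow_succ (-1 : ℂ)]
    linear_combination (-(-1 : ℂ) ^ r) * ((r + 1).factorial : ℂ) * (q.choose (r + 1) : ℂ) *
        (starRingEnd ℂ z) ^ (q - (r + 1)) * (-h2) -
      (-1 : ℂ) ^ r * (p.choose r : ℂ) * z ^ (p - r) * (starRingEnd ℂ z) ^ (q - (r + 1)) * (-h1)
  · simp
    ring

theorem hasTemperateGrowth_hermiteJ (p q : ℕ) :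
    (fun z : ℂ => hermiteJ p q z 1).HasTemperateGrowth := by
  have h1 : (fun z : ℂ => starRingEnd ℂ z).HasTemperateGrowth :=
    hasTemperateGrowth_conj Function.HasTemperateGrowth.id'
  unfold hermiteJ
  fun_prop

theorem dz_id (z v : ℂ) : dz (fun x => x) z v = v := by
  rw [dz, fderiv_fun_id]
  simp only [ContinuousLinearMap.id_apply, smul_eq_mul]
  linear_combination (-(1 / 2 : ℂ)) * v * Complex.I_sq

theorem dzbar_id (z v : ℂ) : dzbar (fun x => x) z v = 0 := by
  rw [dzbar, fderiv_fun_id]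
  simp only [ContinuousLinearMap.id_apply, smul_eq_mul]
  linear_combination (1 / 2 : ℂ) * v * Complex.I_sq

theorem dz_conj_pow (q : ℕ) (z v : ℂ) : dz (fun x => (starRingEnd ℂ x) ^ q) z v = 0 := by
  have h1 : (fun z : ℂ => starRingEnd ℂ z).HasTemperateGrowth :=
    hasTemperateGrowth_conj Function.HasTemperateGrowth.id'
  induction q with
  | zero => simp [dz]
  | succ q ih =>
    simp only [pow_succ]
    rw [dz_mul (h1.fun_pow q).differentiable h1.differentiable, ih,
      dz_conj (f := fun x => x) differentiable_fun_id, dzbar_id]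
    simp

theorem dz_hermiteJ (p q : ℕ) (z : ℂ) :
    dz (fun x => hermiteJ p q x 1) z 1 = p * hermiteJ (p - 1) q z 1 := by
  have hd := fun p q => (hasTemperateGrowth_hermiteJ p q).differentiable
  induction p generalizing q with
  | zero => simp [hermiteJ_zero_left, dz_conj_pow]
  | succ p ih =>
    have h1 : (fun x => hermiteJ (p + 1) q x 1) = fun x => ∑ b : Bool,
        (if b then (1 : ℂ) else -q) * (if b then x * hermiteJ p q x 1
          else hermiteJ p (q - 1) x 1) := by
      funext x
      rw [hermiteJ_succ_left, Fintype.sum_bool]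
      simp [sub_eq_add_neg]
    rw [h1, dz_sum _ (f := fun (b : Bool) x => if b then x * hermiteJ p q x 1
      else hermiteJ p (q - 1) x 1), Fintype.sum_bool]
    · simp only [if_true, Bool.false_eq_true, if_false]
      rw [dz_mul differentiable_fun_id (hd p q), dz_id, ih, ih]
      rcases p with _ | p
      · simp
      · rw [Nat.add_sub_cancel, Nat.add_sub_cancel, hermiteJ_succ_left p q]
        push_cast
        ring
    · intro b
      cases b
      · simpa using hd p (q - 1)
      · simpa using differentiable_fun_id.fun_mul (hd p q)

end Hermite

/-! ### Products of complex Hermite polynomials -/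

section Products

variable {κ : Type*}

section Mult

variable [DecidableEq κ]

theorem mult_eq_sum {m : ℕ} (j : Fin m → κ) (k : κ) :
    mult j k = ∑ a, if j a = k then 1 else 0 := by
  rw [mult, Nat.card_eq_fintype_card, Fintype.card_subtype, Finset.card_filter]

theorem mult_insertNth {m : ℕ} (a : Fin (m + 1)) (i : κ) (j : Fin m → κ) :
    mult (a.insertNth i j : Fin (m + 1) → κ) = Function.update (mult j) i (mult j i + 1) := by
  funext k
  rw [mult_eq_sum, Fin.sum_univ_succAbove _ a]
  simp only [Fin.insertNth_apply_same, Fin.insertNth_apply_succAbove]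
  rw [← mult_eq_sum]
  rcases eq_or_ne k i with rfl | h
  · simp [add_comm]
  · simp [Function.update_of_ne h, h.symm]

end Mult

variable [Fintype κ]

/-- The product `∏_k J_{μ_k, ν_k}(z_k, 1)` for multi-indices `μ`, `ν`. -/
noncomputable def hermiteProd (μ ν : κ → ℕ) (z : κ → ℂ) : ℂ :=
  ∏ k, hermiteJ (μ k) (ν k) (z k) 1

theorem hasTemperateGrowth_hermiteJ_coord (p q : ℕ) (k : κ) :
    (fun z : κ → ℂ => hermiteJ p q (z k) 1).HasTemperateGrowth :=
  hasTemperateGrowth_comp_clm (f := fun z => hermiteJ p q z 1) (hasTemperateGrowth_hermiteJ p q)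
    (ContinuousLinearMap.proj (R := ℂ) (φ := fun _ : κ => ℂ) k)

theorem hasTemperateGrowth_prod_hermiteJ (s : Finset κ) (μ ν : κ → ℕ) :
    (fun z : κ → ℂ => ∏ k ∈ s, hermiteJ (μ k) (ν k) (z k) 1).HasTemperateGrowth := by
  have h : ∀ k ∈ s, (fun z : κ → ℂ => hermiteJ (μ k) (ν k) (z k) 1).HasTemperateGrowth :=
    fun k _ => hasTemperateGrowth_hermiteJ_coord (μ k) (ν k) k
  exact hasTemperateGrowth_prod s h

theorem hasTemperateGrowth_hermiteProd (μ ν : κ → ℕ) :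
    (hermiteProd μ ν).HasTemperateGrowth :=
  hasTemperateGrowth_prod_hermiteJ Finset.univ μ ν

theorem hermiteProd_conj (μ ν : κ → ℕ) (z : κ → ℂ) :
    starRingEnd ℂ (hermiteProd μ ν z) = hermiteProd ν μ z := by
  simp [hermiteProd, map_prod, hermiteJ_conj]

variable [DecidableEq κ]

theorem hermiteProd_update (μ ν : κ → ℕ) (i : κ) (a b : ℕ) (z : κ → ℂ) :
    hermiteProd (Function.update μ i a) (Function.update ν i b) z =
      hermiteJ a b (z i) 1 * ∏ k ∈ Finset.univ.erase i, hermiteJ (μ k) (ν k) (z k) 1 := by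
  rw [hermiteProd, ← Finset.mul_prod_erase _ _ (Finset.mem_univ i)]
  congr 1
  · simp
  · refine Finset.prod_congr rfl fun k hk => ?_
    rw [Function.update_of_ne (Finset.ne_of_mem_erase hk),
      Function.update_of_ne (Finset.ne_of_mem_erase hk)]

theorem dz_hermiteProd (μ ν : κ → ℕ) (i : κ) (z : κ → ℂ) :
    dz (hermiteProd μ ν) z (Pi.single i 1) =
      μ i * hermiteProd (Function.update μ i (μ i - 1)) ν z := by
  have hd : ∀ k : κ, Differentiable ℝ fun z : κ → ℂ => hermiteJ (μ k) (ν k) (z k) 1 := fun k =>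
    (hasTemperateGrowth_hermiteJ_coord (μ k) (ν k) k).differentiable
  have h1 : hermiteProd μ ν = fun z =>
      hermiteJ (μ i) (ν i) (z i) 1 * ∏ k ∈ Finset.univ.erase i, hermiteJ (μ k) (ν k) (z k) 1 := by
    funext z
    conv_lhs => rw [← Function.update_eq_self i μ, ← Function.update_eq_self i ν]
    rw [hermiteProd_update]
  have h3 : ∀ v : ℂ, fderiv ℝ (fun z : κ → ℂ => ∏ k ∈ Finset.univ.erase i,
      hermiteJ (μ k) (ν k) (z k) 1) z (Pi.single i v) = 0 := by
    intro v
    rw [fderiv_finsetProd fun k _ => hd k z]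
    simp only [_root_.sum_apply, _root_.smul_apply]
    refine Finset.sum_eq_zero fun k hk => ?_
    have h4 := ((hasTemperateGrowth_hermiteJ (μ k) (ν k)).differentiable (z k)).hasFDerivAt.comp z
      ((ContinuousLinearMap.proj (R := ℝ) (φ := fun _ : κ => ℂ) k).hasFDerivAt)
    have h5 := congrArg (fun A => A (Pi.single i v)) h4.fderiv
    have h6 : (Pi.single i v : κ → ℂ) k = 0 := by
      simp [Finset.ne_of_mem_erase hk]
    simp only [ContinuousLinearMap.comp_apply, ContinuousLinearMap.proj_apply, h6, map_zero] at h5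
    rw [smul_eq_mul]
    exact mul_eq_zero_of_right _ h5
  have h2 : dz (fun z : κ → ℂ => ∏ k ∈ Finset.univ.erase i, hermiteJ (μ k) (ν k) (z k) 1) z
      (Pi.single i 1) = 0 := by
    rw [dz, ← Pi.single_smul, h3, h3]
    simp
  have h7 := dz_comp_clm (f := fun z => hermiteJ (μ i) (ν i) z 1)
    (hasTemperateGrowth_hermiteJ (μ i) (ν i)).differentiable
    (ContinuousLinearMap.proj (R := ℂ) (φ := fun _ : κ => ℂ) i) z (Pi.single i 1)
  simp only [ContinuousLinearMap.proj_apply, Pi.single_eq_same, dz_hermiteJ] at h7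
  have h8 := (hasTemperateGrowth_prod_hermiteJ (Finset.univ.erase i) μ ν).differentiable
  have h9 := hermiteProd_update μ ν i (μ i - 1) (ν i) z
  rw [Function.update_eq_self] at h9
  rw [h1, dz_mul (hd i) h8, h2, h7, h9]
  ring

theorem dzbar_hermiteProd (μ ν : κ → ℕ) (i : κ) (z : κ → ℂ) :
    dzbar (hermiteProd μ ν) z (Pi.single i 1) =
      ν i * hermiteProd μ (Function.update ν i (ν i - 1)) z := by
  have h := dzbar_conj (hasTemperateGrowth_hermiteProd ν μ).differentiable z (Pi.single i 1)
  simp only [hermiteProd_conj, dz_hermiteProd, map_mul, map_natCast] at h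
  exact h

/-- The creation formula: multiplication by `z_i` minus `∂̄_i` raises the first multi-index. -/
theorem hermiteProd_succ (μ ν : κ → ℕ) (i : κ) (z : κ → ℂ) :
    hermiteProd (Function.update μ i (μ i + 1)) ν z =
      z i * hermiteProd μ ν z - dzbar (hermiteProd μ ν) z (Pi.single i 1) := by
  rw [dzbar_hermiteProd]
  have h1 := hermiteProd_update μ ν i (μ i + 1) (ν i) z
  have h2 := hermiteProd_update μ ν i (μ i) (ν i) z
  have h3 := hermiteProd_update μ ν i (μ i) (ν i - 1) z
  simp only [Function.update_eq_self] at h1 h2 h3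
  rw [h1, h2, h3, hermiteJ_succ_left]
  ring

/-- `∂_i` of the Hermite product with index lists `j`, `l` removes each occurrence of `i` from `j`
in turn. -/
theorem dz_hermiteProd_mult {m n : ℕ} (j : Fin (m + 1) → κ) (l : Fin n → κ) (i : κ) (z : κ → ℂ) :
    dz (hermiteProd (mult j) (mult l)) z (Pi.single i 1) =
      ∑ a, if j a = i then hermiteProd (mult (a.removeNth j)) (mult l) z else 0 := by
  have h : ∀ a, (if j a = i then hermiteProd (mult (a.removeNth j)) (mult l) z else 0) =
      (if j a = i then 1 else 0) *
        hermiteProd (Function.update (mult j) i (mult j i - 1)) (mult l) z := by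
    intro a
    split_ifs with hj
    · have h1 := mult_insertNth a i (a.removeNth j)
      rw [← hj, Fin.insertNth_self_removeNth, hj] at h1
      rw [one_mul, h1]
      simp
    · simp
  rw [dz_hermiteProd, Finset.sum_congr rfl fun a _ => h a, ← Finset.sum_mul, mult_eq_sum]
  push_cast
  rfl

theorem dz_hermiteProd_mult_zero {n : ℕ} (j : Fin 0 → κ) (l : Fin n → κ) (i : κ) (z : κ → ℂ) :
    dz (hermiteProd (mult j) (mult l)) z (Pi.single i 1) = 0 := by
  rw [dz_hermiteProd, mult_eq_sum]
  simp

theorem hermiteProd_cons {m n : ℕ} (i : κ) (j : Fin m → κ) (l : Fin n → κ) (z : κ → ℂ) :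
    hermiteProd (mult (Fin.cons i j : Fin (m + 1) → κ)) (mult l) z =
      z i * hermiteProd (mult j) (mult l) z -
        dzbar (hermiteProd (mult j) (mult l)) z (Pi.single i 1) := by
  rw [← Fin.insertNth_zero', mult_insertNth, hermiteProd_succ]

end Products

/-! ### The Bessel inequality for Hermite sums -/

section HermiteSum

variable {κ : Type*} [Fintype κ]

/-- The polynomial `∑ c_{j,l} ∏_k J_{m_k, n_k}(z_k, 1)` with `m_k`, `n_k` the multiplicities of `k` in
the index lists `j`, `l`. -/
noncomputable def hermiteSum {m n : ℕ} (c : (Fin m → κ) × (Fin n → κ) → ℂ) (z : κ → ℂ) : ℂ :=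
  ∑ q, c q * hermiteProd (mult q.1) (mult q.2) z

theorem hasTemperateGrowth_hermiteSum {m n : ℕ} (c : (Fin m → κ) × (Fin n → κ) → ℂ) :
    (hermiteSum c).HasTemperateGrowth :=
  Function.HasTemperateGrowth.sum fun q _ => (Function.HasTemperateGrowth.const (c q)).fun_mul
    (hasTemperateGrowth_hermiteProd (mult q.1) (mult q.2))

theorem hermiteSum_conj {m n : ℕ} (c : (Fin m → κ) × (Fin n → κ) → ℂ) (z : κ → ℂ) :
    starRingEnd ℂ (hermiteSum c z) = hermiteSum (fun q => starRingEnd ℂ (c q.swap)) z := by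
  rw [hermiteSum, hermiteSum, map_sum, ← (Equiv.prodComm _ _).sum_comp]
  refine Finset.sum_congr rfl fun q _ => ?_
  simp [hermiteProd_conj]

theorem sum_pi_insertNth {m : ℕ} {β M : Type*} [Fintype β] [AddCommMonoid M] (a : Fin (m + 1))
    (F : (Fin (m + 1) → κ) × β → M) :
    ∑ q, F q = ∑ i, ∑ q : (Fin m → κ) × β, F (a.insertNth i q.1, q.2) := by
  rw [Fintype.sum_prod_type, ← (Fin.insertNthEquiv (fun _ => κ) a).sum_comp, Fintype.sum_prod_type]
  refine Finset.sum_congr rfl fun i _ => ?_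
  rw [Fintype.sum_prod_type]
  rfl

variable [DecidableEq κ]

theorem hermiteSum_succ {m n : ℕ} (c : (Fin (m + 1) → κ) × (Fin n → κ) → ℂ) (z : κ → ℂ) :
    hermiteSum c z = ∑ i, (z i * hermiteSum (fun q => c (Fin.cons i q.1, q.2)) z -
      dzbar (hermiteSum fun q => c (Fin.cons i q.1, q.2)) z (Pi.single i 1)) := by
  have hd := fun (q : (Fin m → κ) × (Fin n → κ)) =>
    (hasTemperateGrowth_hermiteProd (mult q.1) (mult q.2)).differentiable
  rw [hermiteSum, sum_pi_insertNth 0]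
  refine Finset.sum_congr rfl fun i _ => ?_
  unfold hermiteSum
  rw [dzbar_sum _ hd, Finset.mul_sum, ← Finset.sum_sub_distrib]
  refine Finset.sum_congr rfl fun q _ => ?_
  rw [Fin.insertNth_zero', hermiteProd_cons]
  ring

theorem dz_hermiteSum {m n : ℕ} (c : (Fin (m + 1) → κ) × (Fin n → κ) → ℂ) (i : κ) (z : κ → ℂ) :
    dz (hermiteSum c) z (Pi.single i 1) =
      ∑ a : Fin (m + 1), hermiteSum (fun q => c (a.insertNth i q.1, q.2)) z := by
  have hd := fun (q : (Fin (m + 1) → κ) × (Fin n → κ)) =>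
    (hasTemperateGrowth_hermiteProd (mult q.1) (mult q.2)).differentiable
  unfold hermiteSum
  rw [dz_sum _ hd]
  simp only [dz_hermiteProd_mult, Finset.mul_sum]
  rw [Finset.sum_comm]
  refine Finset.sum_congr rfl fun a _ => ?_
  rw [sum_pi_insertNth a, Finset.sum_eq_single i]
  · simp
  · intro i' _ hi'
    simp [hi']
  · simp

theorem dz_hermiteSum_zero {n : ℕ} (c : (Fin 0 → κ) × (Fin n → κ) → ℂ) (i : κ) (z : κ → ℂ) :
    dz (hermiteSum c) z (Pi.single i 1) = 0 := by
  have hd := fun (q : (Fin 0 → κ) × (Fin n → κ)) =>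
    (hasTemperateGrowth_hermiteProd (mult q.1) (mult q.2)).differentiable
  unfold hermiteSum
  rw [dz_sum _ hd]
  simp [dz_hermiteProd_mult_zero]

end HermiteSum

section Bessel

variable {Ω : Type*} [MeasurableSpace Ω] {P : Measure Ω} {H : Type*} {Z : H → Ω → ℂ}
  {κ : Type*} [Fintype κ]

/-- Complex conjugation exchanges the two index lists in the Bessel inequality. -/
theorem bessel_swap {u : κ → H} {m n : ℕ} {C : ℝ}
    (hC : ∀ c : (Fin m → κ) × (Fin n → κ) → ℂ,
      ∫ ω, ‖hermiteSum c fun k => Z (u k) ω‖ ^ 2 ∂P ≤ C * ∑ q, ‖c q‖ ^ 2)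
    (c : (Fin n → κ) × (Fin m → κ) → ℂ) :
    ∫ ω, ‖hermiteSum c fun k => Z (u k) ω‖ ^ 2 ∂P ≤ C * ∑ q, ‖c q‖ ^ 2 := by
  have h := hC fun q => starRingEnd ℂ (c q.swap)
  simp only [← hermiteSum_conj, RCLike.norm_conj] at h
  rwa [← (Equiv.prodComm (Fin n → κ) (Fin m → κ)).sum_comp] at h

variable [NormedAddCommGroup H] [InnerProductSpace ℂ H]

theorem IsIsonormal.integrable_norm_sq (hZ : IsIsonormal Z P) (u : κ → H) {f : (κ → ℂ) → ℂ}
    (hf : f.HasTemperateGrowth) : Integrable (fun ω => ‖f fun k => Z (u k) ω‖ ^ 2) P :=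
  (memLp_two_iff_integrable_sq_norm (hZ.memLp_comp u hf).1).1 (hZ.memLp_comp u hf)

theorem norm_integral_mul_conj_le {f g : Ω → ℂ} (hf : Integrable (fun ω => ‖f ω‖ ^ 2) P)
    (hg : Integrable (fun ω => ‖g ω‖ ^ 2) P) :
    ‖∫ ω, f ω * starRingEnd ℂ (g ω) ∂P‖ ≤
      (1 / 2) * (∫ ω, ‖f ω‖ ^ 2 ∂P + ∫ ω, ‖g ω‖ ^ 2 ∂P) := by
  rw [← integral_add hf hg, ← integral_const_mul]
  refine norm_integral_le_of_norm_le ((hf.add hg).const_mul _) (ae_of_all _ fun ω => ?_)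
  rw [norm_mul, RCLike.norm_conj]
  nlinarith [sq_nonneg (‖f ω‖ - ‖g ω‖)]

variable [IsProbabilityMeasure P] [DecidableEq κ]

/-- The operator `Φ ↦ Z(u_i) Φ - ∂̄_i Φ` is adjoint to `∂_i`. -/
theorem IsIsonormal.integral_creation (hZ : IsIsonormal Z P) {u : κ → H} (hu : Orthonormal ℂ u)
    (i : κ) {f g : (κ → ℂ) → ℂ} (hf : f.HasTemperateGrowth) (hg : g.HasTemperateGrowth) :
    ∫ ω, (Z (u i) ω * f (fun k => Z (u k) ω) -
        dzbar f (fun k => Z (u k) ω) (Pi.single i 1)) * starRingEnd ℂ (g fun k => Z (u k) ω) ∂P =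
      ∫ ω, f (fun k => Z (u k) ω) *
        starRingEnd ℂ (dz g (fun k => Z (u k) ω) (Pi.single i 1)) ∂P := by
  have hgc := hasTemperateGrowth_conj hg
  have h1 := hZ.integral_mul_self u (u i) (hf.fun_mul hgc)
  have h2 : (fun k => ⟪u i, u k⟫_ℂ) = Pi.single i 1 := by
    funext k
    rw [orthonormal_iff_ite.1 hu i k, Pi.single_apply]
    simp [eq_comm]
  rw [h2] at h1
  simp only [dzbar_mul hf.differentiable hgc.differentiable, dzbar_conj hg.differentiable] at h1
  have i1 : Integrable (fun ω => f (fun k => Z (u k) ω) *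
      starRingEnd ℂ (dz g (fun k => Z (u k) ω) (Pi.single i 1))) P :=
    (hZ.memLp_comp u hf).integrable_mul
      (hZ.memLp_comp u (hasTemperateGrowth_conj (hasTemperateGrowth_dz hg _)))
  have i2 : Integrable (fun ω => starRingEnd ℂ (g fun k => Z (u k) ω) *
      dzbar f (fun k => Z (u k) ω) (Pi.single i 1)) P :=
    (hZ.memLp_comp u hgc).integrable_mul (hZ.memLp_comp u (hasTemperateGrowth_dzbar hf _))
  have i3 : Integrable (fun ω => f (fun k => Z (u k) ω) *
      starRingEnd ℂ (g fun k => Z (u k) ω) * Z (u i) ω) P :=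
    (hZ.memLp_comp u (hf.fun_mul hgc)).integrable_mul (hZ.memLp (u i))
  rw [integral_add i1 i2] at h1
  rw [← sub_eq_iff_eq_add.2 h1, ← integral_sub i3 i2]
  refine integral_congr_ae (ae_of_all _ fun ω => ?_)
  simp only
  ring

/-- The induction step of the Bessel inequality: with `Ψ = ∑_i (Z(u_i) Φ_i - ∂̄_i Φ_i)`, adjointness
gives `E|Ψ|² = ∑_i E[Φ_i conj(∂_i Ψ)]`, and each `∂_i Ψ` is a sum of `m + 1` Hermite sums of lower
order. -/
theorem IsIsonormal.bessel_succ (hZ : IsIsonormal Z P) {u : κ → H} (hu : Orthonormal ℂ u)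
    {m n : ℕ} {C : ℝ} (hC : ∀ c : (Fin m → κ) × (Fin n → κ) → ℂ,
      ∫ ω, ‖hermiteSum c fun k => Z (u k) ω‖ ^ 2 ∂P ≤ C * ∑ q, ‖c q‖ ^ 2)
    (c : (Fin (m + 1) → κ) × (Fin n → κ) → ℂ) :
    ∫ ω, ‖hermiteSum c fun k => Z (u k) ω‖ ^ 2 ∂P ≤ ((m + 1) * C) * ∑ q, ‖c q‖ ^ 2 := by
  set Φ : Fin (m + 1) → κ → (κ → ℂ) → ℂ :=
    fun a i => hermiteSum fun q : (Fin m → κ) × (Fin n → κ) => c (a.insertNth i q.1, q.2) with hΦ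
  have hg := hasTemperateGrowth_hermiteSum c
  have hΦt : ∀ a i, (Φ a i).HasTemperateGrowth := fun a i => hasTemperateGrowth_hermiteSum _
  have hdec : ∀ z, hermiteSum c z = ∑ i, (z i * Φ 0 i z - dzbar (Φ 0 i) z (Pi.single i 1)) := by
    intro z
    rw [hermiteSum_succ]
    simp only [hΦ, Fin.insertNth_zero']
  have hcr : ∀ i, (fun z : κ → ℂ => z i * Φ 0 i z -
      dzbar (Φ 0 i) z (Pi.single i 1)).HasTemperateGrowth := fun i =>
    ((ContinuousLinearMap.proj (R := ℝ) (φ := fun _ : κ => ℂ) i).hasTemperateGrowth.fun_mul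
      (hΦt 0 i)).fun_sub (hasTemperateGrowth_dzbar (hΦt 0 i) _)
  have hnorm : ((∫ ω, ‖hermiteSum c fun k => Z (u k) ω‖ ^ 2 ∂P : ℝ) : ℂ) =
      ∑ i, ∑ a, ∫ ω, Φ 0 i (fun k => Z (u k) ω) *
        starRingEnd ℂ (Φ a i fun k => Z (u k) ω) ∂P := by
    have h1 : ∀ ω, ((‖hermiteSum c fun k => Z (u k) ω‖ ^ 2 : ℝ) : ℂ) =
        ∑ i, (Z (u i) ω * Φ 0 i (fun k => Z (u k) ω) -
          dzbar (Φ 0 i) (fun k => Z (u k) ω) (Pi.single i 1)) *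
            starRingEnd ℂ (hermiteSum c fun k => Z (u k) ω) := fun ω => by
      rw [← Finset.sum_mul, ← hdec, Complex.mul_conj, Complex.normSq_eq_norm_sq]
    rw [← integral_complex_ofReal]
    simp only [h1]
    rw [integral_finsetSum _ fun i _ => hZ.integrable_comp u
      ((hcr i).fun_mul (hasTemperateGrowth_conj hg))]
    refine Finset.sum_congr rfl fun i _ => ?_
    rw [hZ.integral_creation hu i (hΦt 0 i) hg]
    simp only [dz_hermiteSum, map_sum, Finset.mul_sum]
    exact integral_finsetSum _ fun a _ => (hZ.memLp_comp u (hΦt 0 i)).integrable_mul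
      (hZ.memLp_comp u (hasTemperateGrowth_conj (hΦt a i)))
  have hnn : 0 ≤ ∫ ω, ‖hermiteSum c fun k => Z (u k) ω‖ ^ 2 ∂P :=
    integral_nonneg fun ω => by positivity
  -- For each fixed position `a`, splitting off the `a`-th index merely reindexes the array `c`.
  have hsum : ∀ a : Fin (m + 1), ∑ i, ∫ ω, ‖Φ a i fun k => Z (u k) ω‖ ^ 2 ∂P ≤
      C * ∑ q, ‖c q‖ ^ 2 := by
    intro a
    rw [sum_pi_insertNth a, Finset.mul_sum]
    exact Finset.sum_le_sum fun i _ => hC _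
  calc ∫ ω, ‖hermiteSum c fun k => Z (u k) ω‖ ^ 2 ∂P
      = ‖((∫ ω, ‖hermiteSum c fun k => Z (u k) ω‖ ^ 2 ∂P : ℝ) : ℂ)‖ := by
        rw [Complex.norm_real, Real.norm_of_nonneg hnn]
    _ ≤ ∑ i, ∑ a, (1 / 2) * (∫ ω, ‖Φ 0 i fun k => Z (u k) ω‖ ^ 2 ∂P +
          ∫ ω, ‖Φ a i fun k => Z (u k) ω‖ ^ 2 ∂P) := by
        rw [hnorm]
        refine (norm_sum_le _ _).trans (Finset.sum_le_sum fun i _ => ?_)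
        refine (norm_sum_le _ _).trans (Finset.sum_le_sum fun a _ => ?_)
        exact norm_integral_mul_conj_le (hZ.integrable_norm_sq u (hΦt 0 i))
          (hZ.integrable_norm_sq u (hΦt a i))
    _ = ∑ a, (1 / 2) * (∑ i, ∫ ω, ‖Φ 0 i fun k => Z (u k) ω‖ ^ 2 ∂P +
          ∑ i, ∫ ω, ‖Φ a i fun k => Z (u k) ω‖ ^ 2 ∂P) := by
        rw [Finset.sum_comm]
        refine Finset.sum_congr rfl fun a _ => ?_
        rw [← Finset.mul_sum, Finset.sum_add_distrib]
    _ ≤ ∑ _a : Fin (m + 1), C * ∑ q, ‖c q‖ ^ 2 :=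
        Finset.sum_le_sum fun a _ => by linarith [hsum 0, hsum a]
    _ = ((m + 1) * C) * ∑ q, ‖c q‖ ^ 2 := by
        simp
        ring

/-- The Bessel inequality for Hermite sums over an orthonormal family. -/
theorem IsIsonormal.bessel (hZ : IsIsonormal Z P) {u : κ → H} (hu : Orthonormal ℂ u) (m n : ℕ) :
    ∀ c : (Fin m → κ) × (Fin n → κ) → ℂ,
      ∫ ω, ‖hermiteSum c fun k => Z (u k) ω‖ ^ 2 ∂P ≤
        (m.factorial * n.factorial : ℝ) * ∑ q, ‖c q‖ ^ 2 := by
  induction m with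
  | zero =>
    -- Exchanging the index lists turns the base case into an induction on `n` of the same kind.
    refine bessel_swap ?_
    induction n with
    | zero =>
      intro c
      have hs : ∀ {M : Type} [AddCommMonoid M] (F : (Fin 0 → κ) × (Fin 0 → κ) → M),
          ∑ q, F q = F default := fun F =>
        Fintype.sum_eq_single default fun q hq => absurd (Subsingleton.elim q default) hq
      have h : ∀ z : κ → ℂ, hermiteSum c z = c default := fun z => by
        simp [hermiteSum, hs, hermiteProd, mult_eq_sum, hermiteJ]
      simp [h, hs]
    | succ n ih =>
      intro c
      refine (hZ.bessel_succ hu ih c).trans_eq ?_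
      rw [Nat.factorial_succ n]
      push_cast
      ring
  | succ m ih =>
    intro c
    refine (hZ.bessel_succ hu ih c).trans_eq ?_
    rw [Nat.factorial_succ m]
    push_cast
    ring

end Bessel

/-! ### Series with a Bessel bound -/

section BesselFamily

variable {α E : Type*} [NormedAddCommGroup E] [NormedSpace ℂ E]

/-- A family of vectors whose finite linear combinations satisfy `‖∑ c_a B_a‖² ≤ C ∑ |c_a|²`. -/
def IsBessel (B : α → E) (C : ℝ) : Prop :=
  ∀ (S : Finset α) (c : α → ℂ), ‖∑ a ∈ S, c a • B a‖ ^ 2 ≤ C * ∑ a ∈ S, ‖c a‖ ^ 2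

theorem IsBessel.summable [CompleteSpace E] {B : α → E} {C : ℝ} (hB : IsBessel B C) {c : α → ℂ}
    (hc : Summable fun a => ‖c a‖ ^ 2) : Summable fun a => c a • B a := by
  rw [summable_iff_vanishing_norm]
  intro ε hε
  obtain ⟨s, hs⟩ := summable_iff_vanishing_norm.1 hc (ε ^ 2 / (|C| + 1)) (by positivity)
  refine ⟨s, fun t ht => ?_⟩
  have h1 := hs t ht
  have h2 := hB t c
  have h3 : 0 ≤ ∑ a ∈ t, ‖c a‖ ^ 2 := Finset.sum_nonneg fun a _ => by positivity
  rw [Real.norm_of_nonneg h3, lt_div_iff₀ (by positivity)] at h1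
  refine lt_of_pow_lt_pow_left₀ 2 hε.le (lt_of_le_of_lt h2 ?_)
  nlinarith [le_abs_self C]

/-- It suffices to check the Bessel bound on a cofinal family of finite sets. -/
theorem IsBessel.of_subset {B : α → E} {C : ℝ} (h : ∀ S : Finset α, ∃ T, S ⊆ T ∧ ∀ c : α → ℂ,
    ‖∑ a ∈ T, c a • B a‖ ^ 2 ≤ C * ∑ a ∈ T, ‖c a‖ ^ 2) : IsBessel B C := by
  classical
  intro S c
  obtain ⟨T, hST, hT⟩ := h S
  have h1 := hT fun a => if a ∈ S then c a else 0
  have h2 : ∑ a ∈ T, (if a ∈ S then c a else 0) • B a = ∑ a ∈ S, c a • B a := by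
    rw [← Finset.sum_subset hST]
    · exact Finset.sum_congr rfl fun a ha => by rw [if_pos ha]
    · intro a _ ha
      rw [if_neg ha, zero_smul]
  have h3 : ∑ a ∈ T, ‖if a ∈ S then c a else 0‖ ^ 2 = ∑ a ∈ S, ‖c a‖ ^ 2 := by
    rw [← Finset.sum_subset hST]
    · exact Finset.sum_congr rfl fun a ha => by rw [if_pos ha]
    · intro a _ ha
      simp [if_neg ha]
  rwa [h2, h3] at h1

end BesselFamily

section VectorValued

variable {Ω : Type*} [MeasurableSpace Ω] {P : Measure Ω} {H : Type*} [NormedAddCommGroup H]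
  [InnerProductSpace ℂ H]

theorem coeFn_finsetSum {E α : Type*} [NormedAddCommGroup E] (s : Finset α) (f : α → Lp E 2 P) :
    ((∑ i ∈ s, f i : Lp E 2 P) : Ω → E) =ᵐ[P] fun ω => ∑ i ∈ s, f i ω := by
  classical
  induction s using Finset.induction_on with
  | empty =>
    simp only [Finset.sum_empty]
    exact Lp.coeFn_zero E 2 P
  | insert a s ha ih =>
    rw [Finset.sum_insert ha]
    filter_upwards [Lp.coeFn_add (f a) (∑ i ∈ s, f i), ih] with ω h1 h2
    rw [h1, Pi.add_apply, h2, Finset.sum_insert ha]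

/-- The element `F ⊗ x` of `L²(Ω; H)`, for `F ∈ L²(Ω)` and `x ∈ H`. -/
noncomputable def tmulLp (P : Measure Ω) (x : H) : Lp ℂ 2 P →L[ℂ] Lp H 2 P :=
  (ContinuousLinearMap.toSpanSingleton ℂ x).compLpL 2 P

theorem coeFn_tmulLp (x : H) (F : Lp ℂ 2 P) : tmulLp P x F =ᵐ[P] fun ω => F ω • x :=
  (ContinuousLinearMap.toSpanSingleton ℂ x).coeFn_compLpL F

theorem inner_tmulLp (x y : H) (F G : Lp ℂ 2 P) :
    ⟪tmulLp P x F, tmulLp P y G⟫_ℂ = ⟪F, G⟫_ℂ * ⟪x, y⟫_ℂ := by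
  rw [L2.inner_def, L2.inner_def, ← integral_mul_const]
  refine integral_congr_ae ?_
  filter_upwards [coeFn_tmulLp x F, coeFn_tmulLp y G] with ω h1 h2
  rw [h1, h2, inner_smul_left, inner_smul_right, RCLike.inner_apply]
  ring

theorem innerLp_tmulLp (h x : H) (F : Lp ℂ 2 P) :
    innerLp P h (tmulLp P x F) = ⟪h, x⟫_ℂ • F := by
  refine Lp.ext ?_
  filter_upwards [coeFn_innerLp h (tmulLp P x F), coeFn_tmulLp x F,
    Lp.coeFn_smul (⟪h, x⟫_ℂ) F] with ω h1 h2 h3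
  rw [h1, h2, h3, inner_smul_right, Pi.smul_apply, smul_eq_mul, mul_comm]

theorem norm_sum_tmulLp {ι : Type*} {e : ι → H} (he : Orthonormal ℂ e) (I : Finset ι)
    (W : ι → Lp ℂ 2 P) : ‖∑ i ∈ I, tmulLp P (e i) (W i)‖ ^ 2 = ∑ i ∈ I, ‖W i‖ ^ 2 := by
  classical
  have h : (((‖∑ i ∈ I, tmulLp P (e i) (W i)‖ ^ 2 : ℝ)) : ℂ) =
      ((∑ i ∈ I, ‖W i‖ ^ 2 : ℝ) : ℂ) := by
    push_cast
    rw [← Complex.coe_algebraMap, ← inner_self_eq_norm_sq_to_K, sum_inner]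
    refine Finset.sum_congr rfl fun i hi => ?_
    rw [inner_sum, Finset.sum_eq_single i]
    · rw [inner_tmulLp, orthonormal_iff_ite.1 he i i, if_pos rfl, mul_one,
        inner_self_eq_norm_sq_to_K, Complex.coe_algebraMap]
      rfl
    · intro j _ hj
      rw [inner_tmulLp, orthonormal_iff_ite.1 he i j, if_neg hj.symm, mul_zero]
    · exact fun h => absurd hi h
  exact_mod_cast h

/-- Tensoring a Bessel family with an orthonormal one gives a Bessel family. -/
theorem IsBessel.tmulLp {ι α : Type*} {e : ι → H} (he : Orthonormal ℂ e) {B : α → Lp ℂ 2 P}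
    {C : ℝ} (hB : IsBessel B C) :
    IsBessel (fun q : ι × α => tmulLp P (e q.1) (B q.2)) C := by
  classical
  refine IsBessel.of_subset fun S => ⟨S.image Prod.fst ×ˢ S.image Prod.snd,
    Finset.subset_product, fun c => ?_⟩
  have h1 : ∑ q ∈ S.image Prod.fst ×ˢ S.image Prod.snd, c q • ComplexWiener.tmulLp P (e q.1) (B q.2) =
      ∑ i ∈ S.image Prod.fst, ComplexWiener.tmulLp P (e i)
        (∑ a ∈ S.image Prod.snd, c (i, a) • B a) := by
    rw [Finset.sum_product]
    refine Finset.sum_congr rfl fun i _ => ?_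
    rw [map_sum]
    exact Finset.sum_congr rfl fun a _ => by rw [map_smul]
  rw [h1, norm_sum_tmulLp he, Finset.sum_product, Finset.mul_sum]
  exact Finset.sum_le_sum fun i _ => hB _ _

end VectorValued

/-! ### The integrals of the basis tensors as Hermite products -/

section BasisIntegral

variable {Ω : Type*} [MeasurableSpace Ω] {P : Measure Ω} [IsProbabilityMeasure P] {H : Type*}
  [NormedAddCommGroup H] [InnerProductSpace ℂ H] {Z : H → Ω → ℂ} {ι : Type*}

/-- Index lists with entries in `T`, as index lists in `ι`. -/
def liftIndex (T : Finset ι) (m n : ℕ) :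
    ((Fin m → T) × (Fin n → T)) ↪ ((Fin m → ι) × (Fin n → ι)) where
  toFun q := (fun a => q.1 a, fun b => q.2 b)
  inj' q r h := by
    refine Prod.ext (funext fun a => Subtype.ext ?_) (funext fun b => Subtype.ext ?_)
    · exact congrFun (congrArg Prod.fst h) a
    · exact congrFun (congrArg Prod.snd h) b

/-- The finite set of pairs of index lists with entries in `T`. -/
noncomputable def indexSet (T : Finset ι) (m n : ℕ) : Finset ((Fin m → ι) × (Fin n → ι)) :=
  Finset.univ.map (liftIndex T m n)

theorem mem_indexSet {T : Finset ι} {m n : ℕ} {q : (Fin m → ι) × (Fin n → ι)} :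
    q ∈ indexSet T m n ↔ (∀ a, q.1 a ∈ T) ∧ ∀ b, q.2 b ∈ T := by
  rw [indexSet, Finset.mem_map]
  constructor
  · rintro ⟨r, -, rfl⟩
    exact ⟨fun a => (r.1 a).2, fun b => (r.2 b).2⟩
  · rintro ⟨h1, h2⟩
    exact ⟨(fun a => ⟨q.1 a, h1 a⟩, fun b => ⟨q.2 b, h2 b⟩), Finset.mem_univ _, rfl⟩

theorem tendsto_indexSet (m n : ℕ) :
    Tendsto (fun T : Finset ι => indexSet T m n) atTop atTop := by
  classical
  refine tendsto_atTop_finset_of_monotone (fun S T hST q hq => ?_) fun q => ?_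
  · rw [mem_indexSet] at hq ⊢
    exact ⟨fun a => hST (hq.1 a), fun b => hST (hq.2 b)⟩
  · refine ⟨Finset.univ.image q.1 ∪ Finset.univ.image q.2, mem_indexSet.2 ⟨fun a => ?_, fun b => ?_⟩⟩
    · exact Finset.mem_union_left _ (Finset.mem_image_of_mem _ (Finset.mem_univ a))
    · exact Finset.mem_union_right _ (Finset.mem_image_of_mem _ (Finset.mem_univ b))

theorem mult_comp_val {T : Finset ι} {m : ℕ} (j : Fin m → T) (k : T) :
    mult (fun a => (j a : ι)) k = mult j k := by
  classical
  rw [mult_eq_sum, mult_eq_sum]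
  simp only [Subtype.ext_iff]

/-- The normalizations of the Fourier--Hermite polynomials cancel: the integral of a basis tensor
is a product of unnormalized Hermite polynomials with parameter `1`. -/
theorem basisIntegral_ae (hZ : IsIsonormal Z P) (e : ι → H) {T : Finset ι} {m n : ℕ}
    (q : (Fin m → T) × (Fin n → T)) :
    (basisIntegral hZ e (liftIndex T m n q).1 (liftIndex T m n q).2 : Ω → ℂ) =ᵐ[P]
      fun ω => hermiteProd (mult q.1) (mult q.2) fun k => Z (e k) ω := by
  classical
  set j := (liftIndex T m n q).1 with hj
  set l := (liftIndex T m n q).2 with hl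
  have h1 : ∀ ω, (sqrtFactorial j l : ℂ) * fourierHermite Z e j l ω =
      ∏ k ∈ support j l, hermiteJ (mult j k) (mult l k) (Z (e k) ω) 1 := by
    intro ω
    have h2 : (sqrtFactorial j l : ℂ) =
        ∏ k ∈ support j l, ((√((mult j k).factorial * (mult l k).factorial : ℝ) : ℝ) : ℂ) := by
      rw [sqrtFactorial, Real.sqrt_prod _ fun k _ => by positivity]
      push_cast
      rfl
    rw [h2, fourierHermite, ← Finset.prod_mul_distrib]
    refine Finset.prod_congr rfl fun k _ => ?_
    rw [hermiteJ_sqrt_two_mul, mul_assoc ((2 : ℝ) ^ _),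
      Real.sqrt_mul (show (0 : ℝ) ≤ 2 ^ (mult j k + mult l k) by positivity),
      ← Complex.ofReal_pow]
    have h3 : √((2 : ℝ) ^ (mult j k + mult l k)) = √2 ^ (mult j k + mult l k) := by
      rw [Real.sqrt_eq_iff_mul_self_eq (by positivity) (by positivity), ← mul_pow,
        Real.mul_self_sqrt (by norm_num)]
    have h4 : √((mult j k).factorial * (mult l k).factorial : ℝ) ≠ 0 := by positivity
    have h5 : √(2 : ℝ) ^ (mult j k + mult l k) ≠ 0 := by positivity
    rw [h3, ← mul_assoc, ← mul_assoc, ← Complex.ofReal_mul, ← Complex.ofReal_mul]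
    have h6 : √((mult j k).factorial * (mult l k).factorial : ℝ) *
        (1 / (√(2 : ℝ) ^ (mult j k + mult l k) *
          √((mult j k).factorial * (mult l k).factorial : ℝ))) *
        √(2 : ℝ) ^ (mult j k + mult l k) = 1 := by
      field_simp
    rw [h6, Complex.ofReal_one, one_mul]
  have h2 : ∀ ω, ∏ k ∈ support j l, hermiteJ (mult j k) (mult l k) (Z (e k) ω) 1 =
      hermiteProd (mult q.1) (mult q.2) fun k : T => Z (e k) ω := by
    intro ω
    have hsub : support j l ⊆ T := by
      intro k hk
      simp only [support, Finset.mem_union, Finset.mem_image, Finset.mem_univ, true_and] at hk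
      rcases hk with ⟨a, rfl⟩ | ⟨b, rfl⟩
      · exact (q.1 a).2
      · exact (q.2 b).2
    rw [Finset.prod_subset hsub, ← Finset.prod_coe_sort, hermiteProd]
    · refine Finset.prod_congr rfl fun k _ => ?_
      rw [← mult_comp_val q.1, ← mult_comp_val q.2]
      rfl
    -- Indices in `T` outside the support contribute `J_{0,0} = 1`.
    · intro k _ hk
      have h3 : mult j k = 0 ∧ mult l k = 0 := by
        simp only [support, Finset.mem_union, Finset.mem_image, Finset.mem_univ, true_and,
          not_or, not_exists] at hk
        rw [mult_eq_sum, mult_eq_sum]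
        exact ⟨Finset.sum_eq_zero fun a _ => if_neg (hk.1 a),
          Finset.sum_eq_zero fun b _ => if_neg (hk.2 b)⟩
      rw [h3.1, h3.2]
      simp [hermiteJ]
  rw [basisIntegral]
  filter_upwards [Lp.coeFn_smul (sqrtFactorial j l : ℂ)
    ((memLp_fourierHermite hZ e j l).toLp (fourierHermite Z e j l)),
    (memLp_fourierHermite hZ e j l).coeFn_toLp] with ω a1 a2
  rw [a1, Pi.smul_apply, a2, smul_eq_mul, h1, h2]

theorem sum_basisIntegral_ae [DecidableEq ι] (hZ : IsIsonormal Z P) (e : ι → H) (T : Finset ι)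
    {m n : ℕ} (c : (Fin m → ι) × (Fin n → ι) → ℂ) :
    ((∑ q ∈ indexSet T m n, c q • basisIntegral hZ e q.1 q.2 : Lp ℂ 2 P) : Ω → ℂ) =ᵐ[P]
      fun ω => hermiteSum (fun q => c (liftIndex T m n q)) fun k : T => Z (e k) ω := by
  rw [indexSet, Finset.sum_map]
  have h1 : ∀ᵐ ω ∂P, ∀ q : (Fin m → T) × (Fin n → T),
      (c (liftIndex T m n q) • basisIntegral hZ e (liftIndex T m n q).1 (liftIndex T m n q).2 :
        Lp ℂ 2 P) ω = c (liftIndex T m n q) *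
          hermiteProd (mult q.1) (mult q.2) fun k => Z (e k) ω := by
    rw [ae_all_iff]
    intro q
    filter_upwards [Lp.coeFn_smul (c (liftIndex T m n q))
      (basisIntegral hZ e (liftIndex T m n q).1 (liftIndex T m n q).2),
      basisIntegral_ae hZ e q] with ω a1 a2
    rw [a1, Pi.smul_apply, a2, smul_eq_mul]
  filter_upwards [coeFn_finsetSum (P := P) Finset.univ fun q : (Fin m → T) × (Fin n → T) =>
    c (liftIndex T m n q) • basisIntegral hZ e (liftIndex T m n q).1 (liftIndex T m n q).2, h1]
    with ω a1 a2
  rw [a1, hermiteSum]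
  exact Finset.sum_congr rfl fun q _ => a2 q

/-- The integrals of the basis tensors form a Bessel family with constant `m! n!`. -/
theorem IsIsonormal.isBessel_basisIntegral (hZ : IsIsonormal Z P) {e : ι → H}
    (he : Orthonormal ℂ e) (m n : ℕ) :
    IsBessel (fun q : (Fin m → ι) × (Fin n → ι) => basisIntegral hZ e q.1 q.2)
      (m.factorial * n.factorial) := by
  classical
  refine IsBessel.of_subset fun S => ?_
  obtain ⟨T, hT⟩ := ((tendsto_indexSet (ι := ι) m n).eventually (eventually_ge_atTop S)).exists
  refine ⟨indexSet T m n, hT, fun c => ?_⟩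
  have h1 := hZ.bessel (u := fun k : T => e k) (he.comp _ Subtype.val_injective) m n
    fun q => c (liftIndex T m n q)
  have h2 : ‖∑ q ∈ indexSet T m n, c q • basisIntegral hZ e q.1 q.2‖ ^ 2 =
      ∫ ω, ‖hermiteSum (fun q => c (liftIndex T m n q)) fun k : T => Z (e k) ω‖ ^ 2 ∂P := by
    have h3 : ∀ F : Lp ℂ 2 P, ‖F‖ ^ 2 = ∫ ω, ‖F ω‖ ^ 2 ∂P := fun F => by
      have h4 := inner_self_eq_norm_sq_to_K (𝕜 := ℂ) F
      rw [L2.inner_def] at h4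
      simp only [inner_self_eq_norm_sq_to_K, Complex.coe_algebraMap, ← Complex.ofReal_pow] at h4
      rw [integral_complex_ofReal] at h4
      exact_mod_cast h4.symm
    rw [h3]
    refine integral_congr_ae ?_
    filter_upwards [sum_basisIntegral_ae hZ e T c] with ω hω
    rw [hω]
  have h5 : ∑ q ∈ indexSet T m n, ‖c q‖ ^ 2 = ∑ q, ‖c (liftIndex T m n q)‖ ^ 2 := by
    rw [indexSet, Finset.sum_map]
  rw [h2, h5]
  exact h1

end BasisIntegral

/-! ### Differentiation of series of basis integrals -/

section Series

variable {Ω : Type*} [MeasurableSpace Ω] {P : Measure Ω} [IsProbabilityMeasure P] {H : Type*}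
  [NormedAddCommGroup H] [InnerProductSpace ℂ H] {Z : H → Ω → ℂ} {ι : Type*}

/-- The sum in `L²(Ω)` of the integrals of the basis tensors with a given array of coefficients. -/
noncomputable def arrayIntegral (hZ : IsIsonormal Z P) (e : ι → H) {m n : ℕ}
    (c : (Fin m → ι) × (Fin n → ι) → ℂ) : Lp ℂ 2 P :=
  ∑' q, c q • basisIntegral hZ e q.1 q.2

theorem hasSum_arrayIntegral (hZ : IsIsonormal Z P) {e : ι → H} (he : Orthonormal ℂ e) {m n : ℕ}
    {c : (Fin m → ι) × (Fin n → ι) → ℂ} (hc : Summable fun q => ‖c q‖ ^ 2) :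
    HasSum (fun q => c q • basisIntegral hZ e q.1 q.2) (arrayIntegral hZ e c) :=
  ((hZ.isBessel_basisIntegral he m n).summable hc).hasSum

theorem liftIndex_insertNth (T : Finset ι) {m n : ℕ} (a : Fin (m + 1)) (i : T)
    (q : (Fin m → T) × (Fin n → T)) :
    liftIndex T (m + 1) n (a.insertNth i q.1, q.2) =
      (a.insertNth (i : ι) (liftIndex T m n q).1, (liftIndex T m n q).2) := by
  refine Prod.ext (funext fun b => ?_) rfl
  change ((a.insertNth i q.1 : Fin (m + 1) → T) b : ι) = _
  refine Fin.succAboveCases a ?_ (fun k => ?_) b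
  · simp
  · simp only [Fin.insertNth_apply_succAbove]
    rfl

/-- A partial sum over the index lists with entries in a finite set is a smooth variable. If the
array is symmetric in its first `m + 1` indices, all the terms of its derivative coincide. -/
theorem mem_smoothGraph_partialSum (hZ : IsIsonormal Z P) (e : ι → H) (T : Finset ι) {m n : ℕ}
    {c : (Fin (m + 1) → ι) × (Fin n → ι) → ℂ}
    (hsymm : ∀ (a : Fin (m + 1)) i j l, c (a.insertNth i j, l) = c (Fin.cons i j, l)) :
    ((∑ q ∈ indexSet T (m + 1) n, c q • basisIntegral hZ e q.1 q.2,
      ((m + 1 : ℕ) : ℂ) • ∑ p ∈ T ×ˢ indexSet T m n, c (Fin.cons p.1 p.2.1, p.2.2) •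
        tmulLp P (e p.1) (basisIntegral hZ e p.2.1 p.2.2)) : Lp ℂ 2 P × Lp H 2 P) ∈
      smoothGraph P Z := by
  classical
  refine mem_smoothGraph (fun k : T => e k) (hasTemperateGrowth_hermiteSum
    fun q => c (liftIndex T (m + 1) n q)) (sum_basisIntegral_ae hZ e T c) ?_
  have h1 : ∑ p ∈ T ×ˢ indexSet T m n, c (Fin.cons p.1 p.2.1, p.2.2) •
        tmulLp P (e p.1) (basisIntegral hZ e p.2.1 p.2.2) =
      ∑ i : T, tmulLp P (e i) (∑ q ∈ indexSet T m n,
        c (Fin.cons (i : ι) q.1, q.2) • basisIntegral hZ e q.1 q.2) := by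
    rw [Finset.sum_product, ← Finset.sum_coe_sort]
    refine Finset.sum_congr rfl fun i _ => ?_
    rw [map_sum]
    exact Finset.sum_congr rfl fun q _ => by rw [map_smul]
  rw [h1]
  set W : T → Lp ℂ 2 P := fun i => ∑ q ∈ indexSet T m n,
    c (Fin.cons (i : ι) q.1, q.2) • basisIntegral hZ e q.1 q.2 with hW
  have h2 : ∀ᵐ ω ∂P, ∀ i : T, W i ω =
      hermiteSum (fun q => c (Fin.cons (i : ι) (liftIndex T m n q).1, (liftIndex T m n q).2))
        fun k : T => Z (e k) ω :=
    ae_all_iff.2 fun i => sum_basisIntegral_ae hZ e T fun q => c (Fin.cons (i : ι) q.1, q.2)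
  have h3 : ∀ᵐ ω ∂P, ∀ i : T, tmulLp P (e i) (W i) ω = W i ω • e i :=
    ae_all_iff.2 fun i => coeFn_tmulLp _ _
  filter_upwards [Lp.coeFn_smul ((m + 1 : ℕ) : ℂ) (∑ i : T, tmulLp P (e i) (W i)),
    coeFn_finsetSum (P := P) Finset.univ fun i : T => tmulLp P (e i) (W i), h2, h3]
    with ω a1 a2 a3 a4
  rw [a1, Pi.smul_apply, a2, Finset.smul_sum]
  refine Finset.sum_congr rfl fun i _ => ?_
  rw [a4, a3, dz_hermiteSum]
  simp only [liftIndex_insertNth, hsymm]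
  rw [Finset.sum_const, Finset.card_univ, Fintype.card_fin, ← Nat.cast_smul_eq_nsmul ℂ, smul_assoc]

theorem mem_smoothGraph_partialSum_zero (hZ : IsIsonormal Z P) (e : ι → H) (T : Finset ι) {n : ℕ}
    (c : (Fin 0 → ι) × (Fin n → ι) → ℂ) :
    ((∑ q ∈ indexSet T 0 n, c q • basisIntegral hZ e q.1 q.2, 0) : Lp ℂ 2 P × Lp H 2 P) ∈
      smoothGraph P Z := by
  classical
  refine mem_smoothGraph (fun k : T => e k) (hasTemperateGrowth_hermiteSum
    fun q => c (liftIndex T 0 n q)) (sum_basisIntegral_ae hZ e T c) ?_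
  filter_upwards [Lp.coeFn_zero H 2 P] with ω hω
  rw [hω]
  simp [dz_hermiteSum_zero]

theorem inGraphD_arrayIntegral_zero (hZ : IsIsonormal Z P) {e : ι → H} (he : Orthonormal ℂ e)
    {n : ℕ} {c : (Fin 0 → ι) × (Fin n → ι) → ℂ} (hc : Summable fun q => ‖c q‖ ^ 2) :
    InGraphD P Z (arrayIntegral hZ e c) 0 :=
  mem_closure_of_tendsto (((hasSum_arrayIntegral hZ he hc).comp (tendsto_indexSet 0 n)).prodMk_nhds
    tendsto_const_nhds) (Eventually.of_forall fun T => mem_smoothGraph_partialSum_zero hZ e T c)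

theorem tendsto_product_indexSet (m n : ℕ) :
    Tendsto (fun T : Finset ι => T ×ˢ indexSet T m n) atTop atTop := by
  classical
  refine tendsto_atTop_finset_of_monotone (fun S T hST p hp => ?_) fun p => ?_
  · rw [Finset.mem_product, mem_indexSet] at hp ⊢
    exact ⟨hST hp.1, fun a => hST (hp.2.1 a), fun b => hST (hp.2.2 b)⟩
  · obtain ⟨T, hT1, hT2⟩ := ((eventually_ge_atTop {p.1}).and
      ((tendsto_indexSet (ι := ι) m n).eventually (eventually_ge_atTop {p.2}))).exists
    exact ⟨T, Finset.mem_product.2 ⟨Finset.singleton_subset_iff.1 hT1,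
      Finset.singleton_subset_iff.1 hT2⟩⟩

/-- The derivative of a square summable series of basis integrals with symmetric coefficients
exists, and its component along `h` is `m + 1` times the series whose coefficients are contracted
with `h` in the first index. -/
theorem exists_inGraphD_arrayIntegral [CompleteSpace H] (hZ : IsIsonormal Z P) {e : ι → H}
    (he : Orthonormal ℂ e) {m n : ℕ} {c : (Fin (m + 1) → ι) × (Fin n → ι) → ℂ}
    (hc : Summable fun q => ‖c q‖ ^ 2)
    (hsymm : ∀ (a : Fin (m + 1)) i j l, c (a.insertNth i j, l) = c (Fin.cons i j, l)) :
    ∃ G : Lp H 2 P, InGraphD P Z (arrayIntegral hZ e c) G ∧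
      ∀ (h : H) (d : (Fin m → ι) × (Fin n → ι) → ℂ),
        (∀ q, HasSum (fun i => c (Fin.cons i q.1, q.2) * ⟪h, e i⟫_ℂ) (d q)) →
        innerLp P h G = ((m + 1 : ℕ) : ℂ) • arrayIntegral hZ e d := by
  have hinj : Function.Injective fun p : ι × (Fin m → ι) × (Fin n → ι) =>
      ((Fin.cons p.1 p.2.1 : Fin (m + 1) → ι), p.2.2) := by
    rintro ⟨i, j, l⟩ ⟨i', j', l'⟩ h
    obtain ⟨h1, h2⟩ := Prod.mk.inj h
    obtain ⟨h3, h4⟩ := Fin.cons_inj.1 h1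
    simp only at h2 h3 h4
    rw [h2, h3, h4]
  have hS := (((hZ.isBessel_basisIntegral he m n).tmulLp he).summable
    (c := fun p => c (Fin.cons p.1 p.2.1, p.2.2)) (hc.comp_injective hinj)).hasSum
  refine ⟨((m + 1 : ℕ) : ℂ) • ∑' p : ι × (Fin m → ι) × (Fin n → ι), c (Fin.cons p.1 p.2.1, p.2.2) •
    tmulLp P (e p.1) (basisIntegral hZ e p.2.1 p.2.2), ?_, fun h d hd => ?_⟩
  · exact mem_closure_of_tendsto
      (((hasSum_arrayIntegral hZ he hc).comp (tendsto_indexSet (m + 1) n)).prodMk_nhds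
        ((hS.comp (tendsto_product_indexSet m n)).const_smul _))
      (Eventually.of_forall fun T => mem_smoothGraph_partialSum hZ e T hsymm)
  · rw [map_smul]
    congr 1
    have h1 := hS.mapL (innerLp P h)
    have h2 : HasSum (fun p : ((Fin m → ι) × (Fin n → ι)) × ι =>
        (c (Fin.cons p.2 p.1.1, p.1.2) * ⟪h, e p.2⟫_ℂ) • basisIntegral hZ e p.1.1 p.1.2)
        (innerLp P h (∑' p : ι × (Fin m → ι) × (Fin n → ι), c (Fin.cons p.1 p.2.1, p.2.2) •
          tmulLp P (e p.1) (basisIntegral hZ e p.2.1 p.2.2))) := by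
      rw [← (Equiv.prodComm ι ((Fin m → ι) × (Fin n → ι))).hasSum_iff]
      refine h1.congr_fun fun p => ?_
      simp only [map_smul, innerLp_tmulLp, smul_smul]
      rfl
    -- Summing the index `i` first contracts `c` with `h`, and leaves the series of `d`.
    exact (h2.prod_fiberwise fun q => (hd q).smul_const (basisIntegral hZ e q.1 q.2)).tsum_eq.symm

end Series

/-! ### Coefficients of kernels in orthonormal families -/

section IndexLists

variable {ι α : Type*}

/-- Inserting an entry at position `a` is inserting it in front, up to a cyclic permutation. -/
theorem insertNth_eq_cons_cycleRange {m : ℕ} (a : Fin (m + 1)) (i : ι) (j : Fin m → ι) (v : ι → α) :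
    (fun k => v ((a.insertNth i j : Fin (m + 1) → ι) k)) =
      fun k => (Fin.cons (v i) (fun k => v (j k)) : Fin (m + 1) → α) (a.cycleRange k) := by
  have h : (Fin.cons (v i) (fun k => v (j k)) : Fin (m + 1) → α) =
      fun k => v ((Fin.cons i j : Fin (m + 1) → ι) k) := by
    funext k
    refine Fin.cases ?_ (fun _ => ?_) k <;> simp
  funext k
  rw [h]
  simp only [Fin.cons_apply_cycleRange]

theorem map_cons {m : ℕ} (i : ι) (j : Fin m → ι) (v : ι → α) :
    (fun k => v ((Fin.cons i j : Fin (m + 1) → ι) k)) = Fin.cons (v i) fun k => v (j k) := by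
  funext k
  refine Fin.cases ?_ (fun _ => ?_) k <;> simp

end IndexLists

section Coefficients

variable {H : Type*} [NormedAddCommGroup H] [InnerProductSpace ℂ H] {ι : Type*}

/-- An antilinear isometry reverses inner products. -/
theorem inner_conj_map (J : H ≃ₗᵢ⋆[ℂ] H) (x y : H) : ⟪J x, J y⟫_ℂ = ⟪y, x⟫_ℂ := by
  -- Polarization: `J` turns the coefficient `i` into `-i`.
  have h1 : ∀ s : ℂ, J (x + s • y) = J x + starRingEnd ℂ s • J y := fun s => by
    rw [map_add, map_smulₛₗ]
  have h2 := h1 Complex.I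
  have h3 := h1 (-Complex.I)
  simp only [map_neg, Complex.conj_I, neg_smul, neg_neg, ← sub_eq_add_neg] at h2 h3
  rw [← inner_conj_symm y x, inner_eq_sum_norm_sq_div_four x y,
    inner_eq_sum_norm_sq_div_four (J x) (J y)]
  simp only [RCLike.I_to_complex, ← h2, ← h3, ← map_add, ← map_sub, J.norm_map]
  simp [map_ofNat]
  ring

theorem orthonormal_conj (J : H ≃ₗᵢ⋆[ℂ] H) {e : ι → H} (he : Orthonormal ℂ e) :
    Orthonormal ℂ fun i => J (e i) := by
  refine ⟨fun i => by rw [J.norm_map, he.1], fun i j hij => ?_⟩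
  simp only [inner_conj_map]
  exact he.2 hij.symm

theorem hasSum_basis (e : HilbertBasis ι ℂ H) (h : H) :
    HasSum (fun i => ⟪e i, h⟫_ℂ • e i) h := by
  simpa [HilbertBasis.repr_apply_apply] using e.hasSum_repr h

theorem hasSum_conj_basis {J : H ≃ₗᵢ⋆[ℂ] H} (hJ : ∀ h, J (J h) = h) (e : HilbertBasis ι ℂ H)
    (h : H) : HasSum (fun i => ⟪J (e i), h⟫_ℂ • J (e i)) h := by
  have h1 := (hasSum_basis e (J h)).mapL J.toContinuousLinearEquiv.toContinuousLinearMap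
  have h2 : ∀ i, ⟪J (e i), h⟫_ℂ = ⟪J h, e i⟫_ℂ := fun i => by
    conv_lhs => rw [← hJ h, inner_conj_map]
  simp only [h2]
  simpa [hJ, inner_conj_symm] using h1

variable [CompleteSpace H]

theorem hasSum_inner_smul_dual {v : ι → H} {h : H}
    (hv : HasSum (fun i => ⟪v i, h⟫_ℂ • v i) h) :
    HasSum (fun i => ⟪h, v i⟫_ℂ • dual (v i)) (dual h) := by
  have h1 := hv.mapL (InnerProductSpace.toDual ℂ H).toContinuousLinearEquiv.toContinuousLinearMap
  refine h1.congr_fun fun i => ?_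
  simp [dual, inner_conj_symm]

/-- Contracting the first variable of `f` with `h` may be computed by expanding `h` in an orthonormal
family, since the kernel is continuous in each variable. -/
theorem hasSum_coeff_cons_left {m n : ℕ} (f : TensorForm H (m + 1) n) {v : ι → H} {h : H}
    (hv : HasSum (fun i => ⟪v i, h⟫_ℂ • v i) h) (x : Fin m → H) (y : Fin n → H) :
    HasSum (fun i => f.coeff (Fin.cons (v i) x) y * ⟪h, v i⟫_ℂ)
      ((f.evalLeft (dual h)).coeff x y) := by
  classical
  have h0 : ∀ φ : StrongDual ℂ H, (f.evalLeft φ).coeff x y = f.toContinuousLinearMap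
      (Sum.elim (Fin.cons 0 fun a => dual (x a)) fun b => dual (y b)) (Sum.inl 0) φ := fun φ => by
    change f _ = f _
    rw [← Sum.elim_update_left, Fin.update_cons_zero]
    rfl
  rw [h0]
  refine ((hasSum_inner_smul_dual hv).mapL _).congr_fun fun i => ?_
  rw [map_smul, ← h0, coeff_evalLeft, smul_eq_mul, mul_comm]

theorem hasSum_coeff_cons_right {m n : ℕ} (f : TensorForm H m (n + 1)) {v : ι → H} {h : H}
    (hv : HasSum (fun i => ⟪v i, h⟫_ℂ • v i) h) (x : Fin m → H) (y : Fin n → H) :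
    HasSum (fun i => f.coeff x (Fin.cons (v i) y) * ⟪h, v i⟫_ℂ)
      ((f.evalRight (dual h)).coeff x y) := by
  classical
  have h0 : ∀ φ : StrongDual ℂ H, (f.evalRight φ).coeff x y = f.toContinuousLinearMap
      (Sum.elim (fun a => dual (x a)) (Fin.cons 0 fun b => dual (y b))) (Sum.inr 0) φ := fun φ => by
    change f _ = f _
    rw [← Sum.elim_update_right, Fin.update_cons_zero]
    rfl
  rw [h0]
  refine ((hasSum_inner_smul_dual hv).mapL _).congr_fun fun i => ?_
  rw [map_smul, ← h0, coeff_evalRight, smul_eq_mul, mul_comm]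

theorem coeff_perm {m n : ℕ} {f : TensorForm H m n} (hf : IsSymm f) (π : Equiv.Perm (Fin m))
    (σ : Equiv.Perm (Fin n)) (x : Fin m → H) (y : Fin n → H) :
    f.coeff (fun a => x (π a)) (fun b => y (σ b)) = f.coeff x y :=
  hf π σ (fun a => dual (x a)) fun b => dual (y b)

/-- The coefficients of a Hilbert--Schmidt kernel in orthonormal families are square summable. -/
theorem summable_coeff {m n : ℕ} {f : TensorForm H m n} (hf : IsHilbertSchmidt f) {u v : ι → H}
    (hu : Orthonormal ℂ u) (hv : Orthonormal ℂ v) :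
    Summable fun q : (Fin m → ι) × (Fin n → ι) =>
      ‖f.coeff (fun a => u (q.1 a)) (fun b => v (q.2 b))‖ ^ 2 := by
  classical
  obtain ⟨C, hC⟩ := hf
  refine summable_of_sum_le (c := C) (fun q => by positivity) fun S => ?_
  -- Any finite set of index lists is contained in some `T^m × T^n`, where the bound applies to the
  -- orthonormal sets `u(T)` and `v(T)`.
  obtain ⟨T, hT⟩ := ((tendsto_indexSet (ι := ι) m n).eventually (eventually_ge_atTop S)).exists
  refine (Finset.sum_le_sum_of_subset_of_nonneg hT fun q _ _ => by positivity).trans ?_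
  have himg : ∀ {w : ι → H}, Orthonormal ℂ w →
      Orthonormal ℂ ((↑) : {x // x ∈ T.image w} → H) := by
    intro w hw
    have h1 := hw.comp (fun x : {x // x ∈ T.image w} =>
      (Finset.mem_image.1 x.2).choose) (fun x y hxy => by
        have h2 := (Finset.mem_image.1 x.2).choose_spec.2
        have h3 := (Finset.mem_image.1 y.2).choose_spec.2
        refine Subtype.ext ?_
        rw [← h2, ← h3]
        exact congrArg w hxy)
    convert h1 using 1
    funext x
    exact (Finset.mem_image.1 x.2).choose_spec.2.symm
  have h1 := hC (fun _ => T.image u) (fun _ => T.image v) (fun _ => himg hu) (fun _ => himg hv)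
  rw [← Finset.sum_product'] at h1
  refine le_trans (le_of_eq ?_) h1
  have hui := hu.linearIndependent.injective
  have hvi := hv.linearIndependent.injective
  refine Finset.sum_bij (fun q _ => ((fun a => u (q.1 a)), fun b => v (q.2 b))) ?_ ?_ ?_ ?_
  · intro q hq
    rw [mem_indexSet] at hq
    rw [Finset.mem_product, Fintype.mem_piFinset, Fintype.mem_piFinset]
    exact ⟨fun a => Finset.mem_image_of_mem u (hq.1 a), fun b => Finset.mem_image_of_mem v (hq.2 b)⟩
  · intro q _ r _ hqr
    obtain ⟨h2, h3⟩ := Prod.mk.inj hqr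
    exact Prod.ext (funext fun a => hui (congrFun h2 a)) (funext fun b => hvi (congrFun h3 b))
  · intro p hp
    rw [Finset.mem_product, Fintype.mem_piFinset, Fintype.mem_piFinset] at hp
    choose j hj1 hj2 using fun a => Finset.mem_image.1 (hp.1 a)
    choose l hl1 hl2 using fun b => Finset.mem_image.1 (hp.2 b)
    exact ⟨(j, l), mem_indexSet.2 ⟨hj1, hl1⟩, Prod.ext (funext hj2) (funext hl2)⟩
  · intro q _
    rfl

end Coefficients

/-! ### Complex conjugation -/

section Conjugation

variable {Ω : Type*} [MeasurableSpace Ω] {P : Measure Ω} {H : Type*}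
  [NormedAddCommGroup H] [InnerProductSpace ℂ H] {Z : H → Ω → ℂ} {ι : Type*}

/-- Pointwise complex conjugation on `L²(Ω)`. -/
noncomputable def conjLp (P : Measure Ω) : Lp ℂ 2 P →L⋆[ℂ] Lp ℂ 2 P :=
  (starL ℂ : ℂ ≃L⋆[ℂ] ℂ).toContinuousLinearMap.compLpL 2 P

theorem coeFn_conjLp (F : Lp ℂ 2 P) : conjLp P F =ᵐ[P] fun ω => starRingEnd ℂ (F ω) :=
  (starL ℂ : ℂ ≃L⋆[ℂ] ℂ).toContinuousLinearMap.coeFn_compLpL F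

/-- The conjugation of `H` applied pointwise on `L²(Ω; H)`. -/
noncomputable def conjVecLp (P : Measure Ω) (J : H ≃ₗᵢ⋆[ℂ] H) : Lp H 2 P →L⋆[ℂ] Lp H 2 P :=
  J.toContinuousLinearEquiv.toContinuousLinearMap.compLpL 2 P

theorem coeFn_conjVecLp (J : H ≃ₗᵢ⋆[ℂ] H) (G : Lp H 2 P) :
    conjVecLp P J G =ᵐ[P] fun ω => J (G ω) :=
  J.toContinuousLinearEquiv.toContinuousLinearMap.coeFn_compLpL G

theorem conjLp_conjLp (F : Lp ℂ 2 P) : conjLp P (conjLp P F) = F := by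
  refine Lp.ext ?_
  filter_upwards [coeFn_conjLp (conjLp P F), coeFn_conjLp F] with ω h1 h2
  rw [h1, h2, Complex.conj_conj]

theorem conjVecLp_conjVecLp {J : H ≃ₗᵢ⋆[ℂ] H} (hJ : ∀ h, J (J h) = h) (G : Lp H 2 P) :
    conjVecLp P J (conjVecLp P J G) = G := by
  refine Lp.ext ?_
  filter_upwards [coeFn_conjVecLp J (conjVecLp P J G), coeFn_conjVecLp J G] with ω h1 h2
  rw [h1, h2, hJ]

theorem innerLp_conjVecLp {J : H ≃ₗᵢ⋆[ℂ] H} (hJ : ∀ h, J (J h) = h) (h : H) (G : Lp H 2 P) :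
    innerLp P h (conjVecLp P J G) = conjLp P (innerLp P (J h) G) := by
  refine Lp.ext ?_
  filter_upwards [coeFn_innerLp h (conjVecLp P J G), coeFn_conjVecLp J G,
    coeFn_conjLp (innerLp P (J h) G), coeFn_innerLp (J h) G] with ω h1 h2 h3 h4
  rw [h1, h2, h3, h4, inner_conj_symm]
  conv_lhs => rw [← hJ h, inner_conj_map]

/-- `D̄ F = J (D (conj F))` on smooth random variables. -/
theorem mem_smoothGraph_of_mem_smoothGraphBar {J : H ≃ₗᵢ⋆[ℂ] H} (hJ : ∀ h, J (J h) = h)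
    {p : Lp ℂ 2 P × Lp H 2 P} (hp : p ∈ smoothGraphBar P J Z) :
    (conjLp P p.1, conjVecLp P J p.2) ∈ smoothGraph P Z := by
  obtain ⟨k, φ, f, hf, h1, h2⟩ := hp
  refine ⟨k, φ, fun z => starRingEnd ℂ (f z), hasTemperateGrowth_conj hf, ?_, ?_⟩
  · filter_upwards [coeFn_conjLp p.1, h1] with ω a1 a2
    rw [a1, a2]
  · filter_upwards [coeFn_conjVecLp J p.2, h2] with ω a1 a2
    rw [a1, a2, map_sum]
    refine Finset.sum_congr rfl fun i _ => ?_
    rw [map_smulₛₗ, hJ, wirtinger_eq_dz, dz_conj hf.differentiable, wirtingerBar_eq_dzbar]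

theorem mem_smoothGraphBar_of_mem_smoothGraph {J : H ≃ₗᵢ⋆[ℂ] H} {p : Lp ℂ 2 P × Lp H 2 P}
    (hp : p ∈ smoothGraph P Z) : (conjLp P p.1, conjVecLp P J p.2) ∈ smoothGraphBar P J Z := by
  obtain ⟨k, φ, f, hf, h1, h2⟩ := hp
  refine ⟨k, φ, fun z => starRingEnd ℂ (f z), hasTemperateGrowth_conj hf, ?_, ?_⟩
  · filter_upwards [coeFn_conjLp p.1, h1] with ω a1 a2
    rw [a1, a2]
  · filter_upwards [coeFn_conjVecLp J p.2, h2] with ω a1 a2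
    rw [a1, a2, map_sum]
    refine Finset.sum_congr rfl fun i _ => ?_
    rw [map_smulₛₗ, wirtingerBar_eq_dzbar, dzbar_conj hf.differentiable, wirtinger_eq_dz]

/-- Conjugation is a homeomorphism, so the relation between the smooth graphs of `D` and `D̄` passes
to the closures. -/
theorem inGraphDBar_iff {J : H ≃ₗᵢ⋆[ℂ] H} (hJ : ∀ h, J (J h) = h) (F : Lp ℂ 2 P) (G : Lp H 2 P) :
    InGraphDBar P J Z F G ↔ InGraphD P Z (conjLp P F) (conjVecLp P J G) := by
  have hcont : Continuous fun p : Lp ℂ 2 P × Lp H 2 P => (conjLp P p.1, conjVecLp P J p.2) :=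
    ((conjLp P).continuous.comp continuous_fst).prodMk
      ((conjVecLp P J).continuous.comp continuous_snd)
  constructor
  · intro h
    exact map_mem_closure (f := fun p : Lp ℂ 2 P × Lp H 2 P => (conjLp P p.1, conjVecLp P J p.2))
      hcont (show (F, G) ∈ closure (smoothGraphBar P J Z) from h)
      fun p hp => mem_smoothGraph_of_mem_smoothGraphBar hJ hp
  · intro h
    have h1 := map_mem_closure
      (f := fun p : Lp ℂ 2 P × Lp H 2 P => (conjLp P p.1, conjVecLp P J p.2))
      hcont (show (conjLp P F, conjVecLp P J G) ∈ closure (smoothGraph P Z) from h)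
      fun p hp => mem_smoothGraphBar_of_mem_smoothGraph (J := J) hp
    simp only [conjLp_conjLp, conjVecLp_conjVecLp hJ] at h1
    exact h1

variable [IsProbabilityMeasure P]

theorem conjLp_basisIntegral (hZ : IsIsonormal Z P) (e : ι → H) {m n : ℕ} (j : Fin m → ι)
    (l : Fin n → ι) : conjLp P (basisIntegral hZ e j l) = basisIntegral hZ e l j := by
  classical
  obtain ⟨T, hT⟩ := ((tendsto_indexSet (ι := ι) m n).eventually
    (eventually_ge_atTop {(j, l)})).exists
  have hq := mem_indexSet.1 (Finset.singleton_subset_iff.1 hT)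
  let q : (Fin m → T) × (Fin n → T) := (fun a => ⟨j a, hq.1 a⟩, fun b => ⟨l b, hq.2 b⟩)
  refine Lp.ext ?_
  have h1 := basisIntegral_ae hZ e q
  have h2 := basisIntegral_ae hZ e q.swap
  filter_upwards [coeFn_conjLp (basisIntegral hZ e j l), h1, h2] with ω a1 a2 a3
  rw [a1]
  refine (congrArg (starRingEnd ℂ) a2).trans (Eq.trans ?_ a3.symm)
  rw [hermiteProd_conj]
  rfl

theorem summable_norm_sq_conj_swap {α β : Type*} {c : α × β → ℂ} (hc : Summable fun q => ‖c q‖ ^ 2) :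
    Summable fun q : β × α => ‖starRingEnd ℂ (c q.swap)‖ ^ 2 := by
  simp only [RCLike.norm_conj]
  exact (Equiv.prodComm β α).summable_iff.2 hc

theorem conjLp_arrayIntegral (hZ : IsIsonormal Z P) {e : ι → H} (he : Orthonormal ℂ e) {m n : ℕ}
    {c : (Fin m → ι) × (Fin n → ι) → ℂ} (hc : Summable fun q => ‖c q‖ ^ 2) :
    conjLp P (arrayIntegral hZ e c) = arrayIntegral hZ e fun q => starRingEnd ℂ (c q.swap) := by
  have h1 := (hasSum_arrayIntegral hZ he hc).mapL (conjLp P)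
  rw [← (Equiv.prodComm (Fin n → ι) (Fin m → ι)).hasSum_iff] at h1
  refine (HasSum.tsum_eq (h1.congr_fun fun q => ?_)).symm
  simp [conjLp_basisIntegral]

/-- `D̄` vanishes on the series of basis integrals without conjugate variables. -/
theorem inGraphDBar_arrayIntegral_zero (hZ : IsIsonormal Z P) {J : H ≃ₗᵢ⋆[ℂ] H}
    (hJ : ∀ h, J (J h) = h) {e : ι → H} (he : Orthonormal ℂ e) {m : ℕ}
    {c : (Fin m → ι) × (Fin 0 → ι) → ℂ} (hc : Summable fun q => ‖c q‖ ^ 2) :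
    InGraphDBar P J Z (arrayIntegral hZ e c) 0 := by
  rw [inGraphDBar_iff hJ, map_zero, conjLp_arrayIntegral hZ he hc]
  exact inGraphD_arrayIntegral_zero hZ he (summable_norm_sq_conj_swap hc)

theorem IsIsonormal.inGraphDBar_unique [TopologicalSpace.SeparableSpace H] (hZ : IsIsonormal Z P) {J : H ≃ₗᵢ⋆[ℂ] H}
    (hJ : ∀ h, J (J h) = h) {F : Lp ℂ 2 P} {G G' : Lp H 2 P} (h : InGraphDBar P J Z F G)
    (h' : InGraphDBar P J Z F G') : G = G' := by
  rw [inGraphDBar_iff hJ] at h h'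
  rw [← conjVecLp_conjVecLp hJ G, hZ.inGraphD_unique h h', conjVecLp_conjVecLp hJ]

variable [CompleteSpace H]

/-- The counterpart of `exists_inGraphD_arrayIntegral` for `D̄`: the components of the derivative
are the series whose coefficients are contracted in the first conjugate index. -/
theorem exists_inGraphDBar_arrayIntegral (hZ : IsIsonormal Z P) {J : H ≃ₗᵢ⋆[ℂ] H}
    (hJ : ∀ h, J (J h) = h) {e : ι → H} (he : Orthonormal ℂ e) {m n : ℕ}
    {c : (Fin m → ι) × (Fin (n + 1) → ι) → ℂ} (hc : Summable fun q => ‖c q‖ ^ 2)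
    (hsymm : ∀ (b : Fin (n + 1)) i j l, c (j, b.insertNth i l) = c (j, Fin.cons i l)) :
    ∃ G : Lp H 2 P, InGraphDBar P J Z (arrayIntegral hZ e c) G ∧
      ∀ (h : H) (d : (Fin m → ι) × (Fin n → ι) → ℂ), (Summable fun q => ‖d q‖ ^ 2) →
        (∀ q, HasSum (fun i => c (q.1, Fin.cons i q.2) * ⟪h, J (e i)⟫_ℂ) (d q)) →
        innerLp P h G = ((n + 1 : ℕ) : ℂ) • arrayIntegral hZ e d := by
  obtain ⟨G, hG, hG'⟩ := exists_inGraphD_arrayIntegral hZ he (summable_norm_sq_conj_swap hc)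
    fun a i j l => congrArg (starRingEnd ℂ) (hsymm a i l j)
  refine ⟨conjVecLp P J G, ?_, fun h d hd hd' => ?_⟩
  · rw [inGraphDBar_iff hJ, conjVecLp_conjVecLp hJ, conjLp_arrayIntegral hZ he hc]
    exact hG
  · rw [innerLp_conjVecLp hJ, hG' (J h) (fun q => starRingEnd ℂ (d q.swap)) fun q => ?_]
    · rw [map_smulₛₗ, ← conjLp_arrayIntegral hZ he hd, conjLp_conjLp, map_natCast]
    · refine ((hd' q.swap).mapL (starL ℂ : ℂ ≃L⋆[ℂ] ℂ).toContinuousLinearMap).congr_fun fun i => ?_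
      have h1 : starRingEnd ℂ ⟪h, J (e i)⟫_ℂ = ⟪J h, e i⟫_ℂ := by
        rw [inner_conj_symm, ← inner_conj_map J, hJ]
      rw [← h1, ← map_mul]
      rfl

end Conjugation

/-! ### Derivatives of multiple integrals -/

section Kernels

variable {Ω : Type*} [MeasurableSpace Ω] {P : Measure Ω} [IsProbabilityMeasure P] {H : Type*}
  [NormedAddCommGroup H] [InnerProductSpace ℂ H] [CompleteSpace H] {Z : H → Ω → ℂ} {ι : Type*}
  {J : H ≃ₗᵢ⋆[ℂ] H}

/-- The array of coefficients of a kernel in the orthonormal basis `e`. -/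
noncomputable def coeffArray (J : H ≃ₗᵢ⋆[ℂ] H) (e : ι → H) {m n : ℕ} (f : TensorForm H m n)
    (q : (Fin m → ι) × (Fin n → ι)) : ℂ :=
  f.coeff (fun a => e (q.1 a)) fun b => J (e (q.2 b))

theorem summable_coeffArray (J : H ≃ₗᵢ⋆[ℂ] H) {e : ι → H} (he : Orthonormal ℂ e) {m n : ℕ}
    {f : TensorForm H m n} (hf : IsHilbertSchmidt f) :
    Summable fun q : (Fin m → ι) × (Fin n → ι) => ‖coeffArray J e f q‖ ^ 2 := by
  have h := summable_coeff (u := e) (v := fun i => J (e i)) hf he (orthonormal_conj J he)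
  exact h

theorem coeffArray_insertNth_left (e : ι → H) {m n : ℕ} {f : TensorForm H (m + 1) n}
    (hf : IsSymm f) (a : Fin (m + 1)) (i : ι) (j : Fin m → ι) (l : Fin n → ι) :
    coeffArray J e f (a.insertNth i j, l) = coeffArray J e f (Fin.cons i j, l) := by
  simp only [coeffArray]
  rw [insertNth_eq_cons_cycleRange, map_cons]
  exact coeff_perm hf a.cycleRange 1 (Fin.cons (e i) fun k => e (j k)) fun b => J (e (l b))

theorem coeffArray_insertNth_right (e : ι → H) {m n : ℕ} {f : TensorForm H m (n + 1)}
    (hf : IsSymm f) (b : Fin (n + 1)) (i : ι) (j : Fin m → ι) (l : Fin n → ι) :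
    coeffArray J e f (j, b.insertNth i l) = coeffArray J e f (j, Fin.cons i l) := by
  simp only [coeffArray]
  rw [insertNth_eq_cons_cycleRange b i l fun k => J (e k), map_cons i l fun k => J (e k)]
  exact coeff_perm hf 1 b.cycleRange (fun a => e (j a)) (Fin.cons (J (e i)) fun k => J (e (l k)))

/-- By definition `multipleIntegral` is the `arrayIntegral` of the coefficient array of the kernel, and
likewise for its slices. -/
theorem exists_inGraphD_multipleIntegral (hZ : IsIsonormal Z P) (J : H ≃ₗᵢ⋆[ℂ] H)
    (e : HilbertBasis ι ℂ H) {m n : ℕ} (f : SymKernel H m n) :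
    ∃ G : Lp H 2 P, InGraphD P Z (multipleIntegral hZ J e m n f) G ∧
      ∀ h : H, innerLp P h G =
        (m : ℂ) • multipleIntegral hZ J e (m - 1) n (sliceLeft f h) := by
  have hc := summable_coeffArray J e.orthonormal f.2.1
  rcases m with _ | m
  · refine ⟨0, inGraphD_arrayIntegral_zero hZ e.orthonormal hc, fun h => ?_⟩
    rw [Nat.cast_zero, zero_smul, map_zero]
  · obtain ⟨G, hG, hG'⟩ := exists_inGraphD_arrayIntegral hZ e.orthonormal hc
      (coeffArray_insertNth_left e f.2.2)
    refine ⟨G, hG, fun h => hG' h (coeffArray J e (f.1.evalLeft (dual h))) fun q => ?_⟩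
    simp only [coeffArray, map_cons]
    exact hasSum_coeff_cons_left f.1 (hasSum_basis e h) _ _

theorem exists_inGraphDBar_multipleIntegral (hZ : IsIsonormal Z P) (hJ : ∀ h, J (J h) = h)
    (e : HilbertBasis ι ℂ H) {m n : ℕ} (f : SymKernel H m n) :
    ∃ G : Lp H 2 P, InGraphDBar P J Z (multipleIntegral hZ J e m n f) G ∧
      ∀ h : H, innerLp P h G =
        (n : ℂ) • multipleIntegral hZ J e m (n - 1) (sliceRight f h) := by
  have hc := summable_coeffArray J e.orthonormal f.2.1
  rcases n with _ | n
  · refine ⟨0, inGraphDBar_arrayIntegral_zero hZ hJ e.orthonormal hc, fun h => ?_⟩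
    rw [Nat.cast_zero, zero_smul, map_zero]
  · obtain ⟨G, hG, hG'⟩ := exists_inGraphDBar_arrayIntegral hZ hJ e.orthonormal hc
      (coeffArray_insertNth_right e f.2.2)
    refine ⟨G, hG, fun h => hG' h (coeffArray J e (f.1.evalRight (dual h)))
      (summable_coeffArray J e.orthonormal (isHilbertSchmidt_evalRight f.2.1 h)) fun q => ?_⟩
    simp only [coeffArray, map_cons _ _ fun k => J (e k)]
    exact hasSum_coeff_cons_right f.1 (hasSum_conj_basis hJ e h) _ _

end Kernels

end ComplexWiener

open ComplexWiener in
theorem mainTheorem2 {Ω : Type*} [MeasurableSpace Ω] (P : Measure Ω) [IsProbabilityMeasure P]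
    {H : Type*} [NormedAddCommGroup H] [InnerProductSpace ℂ H] [CompleteSpace H]
    [TopologicalSpace.SeparableSpace H]
    (J : H ≃ₗᵢ⋆[ℂ] H) (hJ : ∀ h, J (J h) = h)
    (Z : H → Ω → ℂ) (hZ : IsIsonormal Z P)
    {ι : Type*} (e : HilbertBasis ι ℂ H) (m n : ℕ) (f : SymKernel H m n) :
    (∃ G : Lp H 2 P, HasD P Z (multipleIntegral hZ J e m n f) G ∧
      ∀ h : H, (fun ω => ⟪h, G ω⟫_ℂ) =ᵐ[P]
        ((m : ℂ) • multipleIntegral hZ J e (m - 1) n (sliceLeft f h) : Lp ℂ 2 P)) ∧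
    (∃ G : Lp H 2 P, HasDBar P J Z (multipleIntegral hZ J e m n f) G ∧
      ∀ h : H, (fun ω => ⟪h, G ω⟫_ℂ) =ᵐ[P]
        ((n : ℂ) • multipleIntegral hZ J e m (n - 1) (sliceRight f h) : Lp ℂ 2 P)) := by
  obtain ⟨G, hG, hG'⟩ := exists_inGraphD_multipleIntegral hZ J e f
  obtain ⟨K, hK, hK'⟩ := exists_inGraphDBar_multipleIntegral hZ hJ e f
  refine ⟨⟨G, fun G' => ⟨fun h => hZ.inGraphD_unique h hG, fun h => h ▸ hG⟩, fun h => ?_⟩,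
    ⟨K, fun K' => ⟨fun h => hZ.inGraphDBar_unique hJ h hK, fun h => h ▸ hK⟩, fun h => ?_⟩⟩
  · rw [← hG' h]
    exact (coeFn_innerLp h G).symm
  · rw [← hK' h]
    exact (coeFn_innerLp h K).symm
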